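/- **Setting.** A full conjunctive query (join without projection) $Q(x_1,\dots,x_n)\leftarrow A_1,\dots,A_m$ with $n\ge 1$ variables is given together with the key order $x_1,\dots,x_n$; every variable occurs in some atom, every atom has arity at least $1$, no atom repeats a variable, and each atom lists its variables consistently with the key order. Let $a$ be the maximal arity. An input $I$ assigns a finite relation to each relation symbol; $|I|$ is the total number of tuples of the input relations and $K=|Q(I)|$ the number of answers. In the external-memory model, internal memory holds $M$ words, a block has $B\ge 1$ words, and reading or writing one block costs one I/O. Input relations lie on external storage as TrieArrays: an $\alpha$-ary relation has value arrays $\mathrm{val}_0,\dots,\mathrm{val}_{\alpha-1}$, where $\mathrm{val}_j$ lists the last components of the distinct $(j+1)$-ary prefixes of its tuples in lexicographic order, and index arrays $\mathrm{idx}_0,\dots,\mathrm{idx}_{\alpha-2}$, where $\mathrm{idx}_j$ delimits the children in $\mathrm{val}_{j+1}$ of each entry of $\mathrm{val}_j$. Boxed Leapfrog Triejoin (boxed LFTJ) divides the memory for slices (all of internal memory except a number of work blocks that depends only on the query) evenly among the $n$ dimensions and recursively, for $i=1,\dots,n$, runs through consecutive intervals $[\mathrm{low}_i,\mathrm{high}_i]$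 that cover the domain of $x_i$. For each interval it handles the atoms whose first variable is $x_i$ and the earlier spilled atoms whose next variable is $x_i$. The memory of the dimension (plus what earlier dimensions left over) is divided evenly among these atoms, each getting at least one block, and each atom is probed for the largest upper bound for which its slice from $\mathrm{low}_i$ on fits into its share. If some atom has no such bound, because already the slice of the single value $\mathrm{low}_i$ is too large, then that atom is spilled (left to the dimension of its next variable) and $\mathrm{high}_i=\mathrm{low}_i$; otherwise $\mathrm{high}_i$ is the minimum of the probed bounds. The slices of the atoms that are not spilled are copied to internal memory, and the procedure goes on to dimension $i+1$, or, after dimension $n$, runs Leapfrog Triejoin in internal memory on the slices, appending the answers in the current box to an output buffer of one block that is written when full. Probing is a binary search over the number of values in the slice that follows the index arrays, starts at the position where the previous slice ended, keeps in memory the blocks of the two current ends of the search interval, and does not follow pointers beyond the memory share of the atom. **Theorem.** 1. For every such query $Q$ and every $\lambda>0$ there is a constant $C>0$ such that, for all $B\ge 1$, all $M$ with $M/B\ge 10\,m\,a$, and all inputs $I$ with $M\le\lambda|I|$, boxed LFTJ runs within $M$ words of internal memory, writes every answer exactly once and nothing else, and uses at most $$C\left(\frac{|I|^n}{M^{n-1}B}+\frac{K}{B}\right)$$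 block I/Os. 2. This is worst-case optimal in terms of $n$. For every $n\ge1$ there is $c>0$ such that for every integer $N\ge n$ the Cartesian product query $Q(x_1,\dots,x_n)\leftarrow R_1(x_1),\dots,R_n(x_n)$ has an input $I$ with $|I|=N$ and $c|I|^n\le K\le|I|^n$ such that, for all $M$ and all $B\ge1$, every sequence of external-memory operations (with memory $M$ and block size $B$) that writes a list of all the answers contains at least $c|I|^n/B$ block writes, and costs at least $c\left(\frac{|I|^n}{M^{n-1}B}+\frac KB\right)$ I/Os. -/

import Mathlib

namespace BoxedJoin

/-! ### Full conjunctive queries -/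

/-- A full conjunctive query (no projection): the head consists of all variables
`x_0, …, x_{n-1}`, listed in the chosen key order. Atom `j` uses the relation symbol `rel j`
with the variables `var j 0, var j 1, …`. No atom repeats a variable and all atoms list their
variables consistently with the key order, that is, `var j` is strictly increasing. -/
structure JoinQuery where
  numVars : ℕ
  numRels : ℕ
  numAtoms : ℕ
  arity : Fin numRels → ℕ
  rel : Fin numAtoms → Fin numRels
  var : (j : Fin numAtoms) → Fin (arity (rel j)) → Fin numVars
  numVars_pos : 0 < numVars
  arity_pos : ∀ r, 0 < arity r
  rel_surjective : Function.Surjective rel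
  var_strictMono : ∀ j, StrictMono (var j)
  var_cover : ∀ x, ∃ j p, var j p = x

/-- The largest arity of a relation of the query. -/
def JoinQuery.maxArity (Q : JoinQuery) : ℕ := Finset.univ.sup Q.arity

/-- An input: one finite relation for each relation symbol. Data values are words,
that is, natural numbers; the least value `0` plays the role of `-∞`. -/
abbrev Database (Q : JoinQuery) : Type :=
  (r : Fin Q.numRels) → Finset (Fin (Q.arity r) → ℕ)

/-- `|I|`, the combined number of tuples of the input relations. -/
def Database.size {Q : JoinQuery} (D : Database Q) : ℕ := ∑ r, (D r).card

/-- The result of the query. -/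
def answers (Q : JoinQuery) (D : Database Q) : Set (Fin Q.numVars → ℕ) :=
  {θ | ∀ j, (fun p => θ (Q.var j p)) ∈ D (Q.rel j)}

/-- The Cartesian product `Q(x_0,…,x_{n-1}) ← R_0(x_0), …, R_{n-1}(x_{n-1})`. -/
def cartesian (n : ℕ) (hn : 0 < n) : JoinQuery where
  numVars := n
  numRels := n
  numAtoms := n
  arity := fun _ => 1
  rel := fun j => j
  var := fun j _ => j
  numVars_pos := hn
  arity_pos := fun _ => Nat.one_pos
  rel_surjective := fun j => ⟨j, rfl⟩
  var_strictMono := fun _ p q h => absurd h (by omega)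
  var_cover := fun x => ⟨x, 0, rfl⟩

/-! ### The external-memory model -/

/-- The two kinds of arrays of a TrieArray. -/
inductive ArrayKind
  | val
  | idx

/-- The address of an input block: relation, array of its TrieArray (kind and level), and number
of the block inside that array. Every array starts at a block boundary. -/
structure BlockAddr where
  rel : ℕ
  kind : ArrayKind
  level : ℕ
  block : ℕ

/-- The operations of the external-memory model that concern the two storage levels.
`read` brings one block into internal memory, `write` sends a block of words from internal memory
to the output file, `compute w` creates `w` new words in internal memory, and `discard w` drops
`w` words of internal memory. Computation inside internal memory is free. -/
inductive Op
  | read (addr : BlockAddr)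
  | write (data : List ℕ)
  | compute (w : ℕ)
  | discard (w : ℕ)

/-- `Admissible M B cur tr`: the operations `tr` can be carried out with an internal memory of `M`
words, of which `cur` are occupied at the start, and with blocks of `B` words. -/
def Admissible (M B : ℕ) : ℕ → List Op → Prop
  | cur, [] => cur ≤ M
  | cur, .read _ :: tr => cur + B ≤ M ∧ Admissible M B (cur + B) tr
  | cur, .write data :: tr =>
      data.length ≤ B ∧ data.length ≤ cur ∧ Admissible M B (cur - data.length) tr
  | cur, .compute w :: tr => cur + w ≤ M ∧ Admissible M B (cur + w) tr
  | cur, .discard w :: tr => w ≤ cur ∧ Admissible M B (cur - w) tr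

/-- The number of block writes. -/
def writeCost : List Op → ℕ
  | [] => 0
  | .write _ :: tr => writeCost tr + 1
  | _ :: tr => writeCost tr

/-- The I/O cost: reading or writing a block costs one unit. -/
def ioCost : List Op → ℕ
  | [] => 0
  | .read _ :: tr => ioCost tr + 1
  | .write _ :: tr => ioCost tr + 1
  | _ :: tr => ioCost tr

/-- The contents of the output file. -/
def written : List Op → List ℕ
  | [] => []
  | .write data :: tr => data ++ written tr
  | _ :: tr => written tr

/-- The words `out` are a list of all answers, tuple after tuple, in some order. -/
def ListsAnswers (Q : JoinQuery) (D : Database Q) (out : List ℕ) : Prop :=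
  ∃ L : List (Fin Q.numVars → ℕ),
    (∀ θ, θ ∈ L ↔ θ ∈ answers Q D) ∧ out = L.flatMap List.ofFn

/-- As `ListsAnswers`, with every answer listed exactly once. -/
def ListsAnswersOnce (Q : JoinQuery) (D : Database Q) (out : List ℕ) : Prop :=
  ∃ L : List (Fin Q.numVars → ℕ), L.Nodup ∧
    (∀ θ, θ ∈ L ↔ θ ∈ answers Q D) ∧ out = L.flatMap List.ofFn

/-- What an algorithm with a buffered output does: operations of the model, and words that are
appended to the output. -/
inductive Step
  | io (op : Op)
  | emit (w : ℕ)

/-- Output words are collected in a buffer of one block, which is written when it is full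
and at the very end. -/
def bufferOutput (B : ℕ) : List ℕ → List Step → List Op
  | [], [] => []
  | w :: buf, [] => [.write (w :: buf)]
  | buf, .io op :: tr => op :: bufferOutput B buf tr
  | buf, .emit w :: tr =>
      if B ≤ buf.length + 1 then
        .compute 1 :: .write (buf ++ [w]) :: bufferOutput B [] tr
      else .compute 1 :: bufferOutput B (buf ++ [w]) tr

/-! ### TrieArrays and their slices

The TrieArray of an `a`-ary relation `R` has value arrays `val_0, …, val_{a-1}` and index arrays
`idx_0, …, idx_{a-2}`. The array `val_j` has one entry for each node of the trie at level `j`, that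
is, for each `(j+1)`-ary prefix of a tuple of `R`, in lexicographic order; the entry is the last
component of the prefix. The entries number `q` and `q + 1` of `idx_j` delimit the children in
`val_{j+1}` of the node number `q` of `val_j`, so `idx_j` has one entry more than `val_j`. -/

section Trie

variable {a : ℕ}

/-- The trie nodes at level `j` of a set of tuples. -/
def nodes (S : Finset (Fin a → ℕ)) (j : ℕ) : Finset (List ℕ) :=
  S.image fun x => (List.ofFn x).take (j + 1)

/-- The number of entries of `val_j`. -/
def width (S : Finset (Fin a → ℕ)) (j : ℕ) : ℕ := (nodes S j).card

/-- The number of entries of `idx_j`; an empty slice stores nothing. -/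
def idxLength (S : Finset (Fin a → ℕ)) (j : ℕ) : ℕ :=
  if S.Nonempty then width S j + 1 else 0

/-- The slice of `R` at level `k` for the start tuple `(t_0,…,t_{k-1})` from `t_k` to `h`. -/
def slice (R : Finset (Fin a → ℕ)) (k : Fin a) (t : Fin a → ℕ) (h : ℕ∞) :
    Finset (Fin a → ℕ) :=
  R.filter fun x => (∀ p, p < k → x p = t p) ∧ t k ≤ x k ∧ (x k : ℕ∞) ≤ h

/-- The tuples of `R` that are lexicographically before every tuple that starts with
`(t_0,…,t_k)`, hence before the slice. -/
def before (R : Finset (Fin a → ℕ)) (k : Fin a) (t : Fin a → ℕ) : Finset (Fin a → ℕ) :=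
  R.filter fun x => ∃ p, p ≤ k ∧ (∀ q, q < p → x q = t q) ∧ x p < t p

/-- The position in `val_j` (and `idx_j`), `j ≥ k`, at which the slice begins. -/
def startPos (R : Finset (Fin a → ℕ)) (k : Fin a) (t : Fin a → ℕ) (j : ℕ) : ℕ :=
  width (before R k t) j

/-- The number of words of a slice at level `k`: the levels below `k` hold a single known
value each, and the arrays of the levels `k, …, a-1` are stored. -/
def words (k : ℕ) (S : Finset (Fin a → ℕ)) : ℕ :=
  ∑ j ∈ Finset.Ico k a, width S j + ∑ j ∈ Finset.Ico k (a - 1), idxLength S j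

/-- The number of blocks of internal memory needed for `w` words. -/
def blocksFor (B w : ℕ) : ℕ := (w + B - 1) / B

/-- The numbers of the blocks that hold the `len` entries of an array from position `p` on. -/
def spanned (B p len : ℕ) : List ℕ :=
  if len = 0 then [] else List.range' (p / B) ((p + len - 1) / B - p / B + 1)

/-- Read the `len` entries of an array from position `p` on and keep the first `keep` of them. -/
def copyRange (B r : ℕ) (kind : ArrayKind) (j p len keep : ℕ) : List Step :=
  (spanned B p len).map (fun b => Step.io (.read ⟨r, kind, j, b⟩)) ++
    [.io (.discard ((spanned B p len).length * B - keep))]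

/-- Look at one block of an array. -/
def peek (B r : ℕ) (kind : ArrayKind) (j b : ℕ) : List Step :=
  [.io (.read ⟨r, kind, j, b⟩), .io (.discard B)]

/-! #### Probing -/

/-- The values at level `k` below the start tuple from `t_k` on, in increasing order; they are
consecutive entries of `val_k`. -/
def children (R : Finset (Fin a → ℕ)) (k : Fin a) (t : Fin a → ℕ) : List ℕ :=
  ((slice R k t ⊤).image fun x => x k).sort (· ≤ ·)

/-- The slice that consists of the first `u` of these values. -/
def headSlice (R : Finset (Fin a → ℕ)) (k : Fin a) (t : Fin a → ℕ) (u : ℕ) :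
    Finset (Fin a → ℕ) :=
  (slice R k t ⊤).filter fun x => x k ∈ (children R k t).take u

/-- The slice of the first `u` values needs at most `m` blocks. -/
abbrev Fits (B m : ℕ) (R : Finset (Fin a → ℕ)) (k : Fin a) (t : Fin a → ℕ) (u : ℕ) : Prop :=
  blocksFor B (words k (headSlice R k t u)) ≤ m

/-- The block of `idx_j` with the entry that ends the slice of the first `u` values.
Pointers are not followed further than `m` blocks behind the start of the slice, since such a slice
is known to be too large. -/
def endBlock (B m : ℕ) (R : Finset (Fin a → ℕ)) (k : Fin a) (t : Fin a → ℕ) (j u : ℕ) : ℕ :=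
  (startPos R k t j + min (width (headSlice R k t u) j) (m * B)) / B

/-- The reads that determine the size of the slice of the first `u` values by following the
index arrays, when the blocks for the two ends `lo` and `hi` of the search interval are in memory.
A block that is read takes the place of one of these. -/
def guessReads (B r m : ℕ) (R : Finset (Fin a → ℕ)) (k : Fin a) (t : Fin a → ℕ)
    (lo u hi : ℕ) : List Step :=
  (List.range' k (a - 1 - k)).flatMap fun j =>
    if endBlock B m R k t j u = endBlock B m R k t j lo ∨
        endBlock B m R k t j u = endBlock B m R k t j hi then []
    else peek B r .idx j (endBlock B m R k t j u)

/-- Binary search for the largest number of values that fit, given that `lo` values fit and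
`hi` values do not. -/
def bisect (B r m : ℕ) (R : Finset (Fin a → ℕ)) (k : Fin a) (t : Fin a → ℕ) (lo hi : ℕ) :
    ℕ × List Step :=
  if hi ≤ lo + 1 then (lo, [])
  else if Fits B m R k t ((lo + hi) / 2) then
    ((bisect B r m R k t ((lo + hi) / 2) hi).1,
      guessReads B r m R k t lo ((lo + hi) / 2) hi ++ (bisect B r m R k t ((lo + hi) / 2) hi).2)
  else
    ((bisect B r m R k t lo ((lo + hi) / 2)).1,
      guessReads B r m R k t lo ((lo + hi) / 2) hi ++ (bisect B r m R k t lo ((lo + hi) / 2)).2)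
termination_by hi - lo
decreasing_by all_goals omega

/-- Probing: the largest `h ≥ t_k` such that the slice from `t_k` to `h` needs at most
`m` blocks of memory, or `none` (a spill) if there is no such `h`; with the steps that find it. -/
def probe (B r m : ℕ) (R : Finset (Fin a → ℕ)) (k : Fin a) (t : Fin a → ℕ) :
    Option ℕ∞ × List Step :=
  let N := (children R k t).length
  let levels := List.range' (k : ℕ) (a - 1 - k)
  let ends : List Step := levels.flatMap fun j =>
    [.io (.read ⟨r, .idx, j, endBlock B m R k t j 0⟩),
      .io (.read ⟨r, .idx, j, endBlock B m R k t j N⟩)]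
  let done : List Step := [.io (.discard (2 * levels.length * B))]
  if Fits B m R k t N then (some ⊤, ends ++ done)
  else
    let s := bisect B r m R k t 0 N
    let c := (children R k t).getD s.1 0
    (if c = t k then none else some ((c - 1 : ℕ) : ℕ∞),
      ends ++ s.2 ++ peek B r .val k ((startPos R k t k + s.1) / B) ++ done)

/-! #### Provisioning -/

/-- Copy the slice from `t_k` to `h` into internal memory. In `val_k` one more entry is inspected
(if there is one), to see that the slice ends. -/
def provision (B r : ℕ) (R : Finset (Fin a → ℕ)) (k : Fin a) (t : Fin a → ℕ) (h : ℕ∞) :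
    List Step :=
  let S := slice R k t h
  ((List.range' (k : ℕ) (a - k)).flatMap fun j =>
    copyRange B r .val j (startPos R k t j)
      (if j = k then min (width S j + 1) (children R k t).length else width S j) (width S j)) ++
  ((List.range' (k : ℕ) (a - 1 - k)).flatMap fun j =>
    copyRange B r .idx j (startPos R k t j) (idxLength S j) (idxLength S j))

/-- For a spilled value, only find where its subtrie ends in the arrays. -/
def locate (B r : ℕ) (R : Finset (Fin a → ℕ)) (k : Fin a) (t : Fin a → ℕ) : List Step :=
  (List.range' (k : ℕ) (a - 1 - k)).flatMap fun j =>
    peek B r .idx j ((startPos R k t j + width (headSlice R k t 1) j) / B)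

end Trie

/-! ### Leapfrog Triejoin in internal memory -/

/-- The state of the boxing procedure: the box boundaries, the level at which an atom that is not
yet provisioned has to be sliced next (`none` for a provisioned atom), and the provisioned slices.
An atom that waits at a level above `0` has been spilled at its earlier levels. -/
structure BoxState (Q : JoinQuery) where
  low : Fin Q.numVars → ℕ
  high : Fin Q.numVars → ℕ∞
  pending : (j : Fin Q.numAtoms) → Option (Fin (Q.arity (Q.rel j)))
  slices : (j : Fin Q.numAtoms) → Finset (Fin (Q.arity (Q.rel j)) → ℕ)

section LFTJ

variable {Q : JoinQuery}

/-- Leapfrog join: the intersection of unary relations, in increasing order. -/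
def leapfrogJoin : List (Finset ℕ) → List ℕ
  | [] => []
  | C :: Cs => (Cs.foldl (· ∩ ·) C).sort (· ≤ ·)

/-- The unary relations that are joined for the variable `d`: for each atom that mentions `d`,
the values of this attribute in the slice after fixing the attributes before it. -/
def columns (st : BoxState Q) (d : Fin Q.numVars) (θ : Fin Q.numVars → ℕ) : List (Finset ℕ) :=
  (List.finRange Q.numAtoms).flatMap fun j =>
    ((List.finRange (Q.arity (Q.rel j))).filter fun p => Q.var j p = d).map fun p =>
      ((st.slices j).filter fun x => ∀ q, q < p → x q = θ (Q.var j q)).image fun x => x p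

/-- Leapfrog Triejoin on the slices, on the box `[low … high]`: backtracking over
the remaining variables in key order, with a leapfrog join for each of them. -/
def lftj (st : BoxState Q) :
    List (Fin Q.numVars) → (Fin Q.numVars → ℕ) → List (Fin Q.numVars → ℕ)
  | [], θ => [θ]
  | d :: ds, θ =>
      ((leapfrogJoin (columns st d θ)).filter fun v =>
        st.low d ≤ v ∧ (v : ℕ∞) ≤ st.high d).flatMap
        fun v => lftj st ds (Function.update θ d v)

/-- Run Leapfrog Triejoin and append its results to the output. -/
def runLFTJ (st : BoxState Q) : List Step :=
  (lftj st (List.finRange Q.numVars) fun _ => 0).flatMap fun θ => (List.ofFn θ).map Step.emit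

/-! ### The boxing procedure -/

/-- The lower bounds of the box at the variables of atom `j`. -/
def startTuple (st : BoxState Q) (j : Fin Q.numAtoms) : Fin (Q.arity (Q.rel j)) → ℕ :=
  fun p => st.low (Q.var j p)

/-- The level at which atom `j` is sliced at dimension `i`; `none` if it is not handled there.
These are the atoms with `x_i` as first variable, and the spilled atoms with `x_i` as
next variable. -/
def active (st : BoxState Q) (i : Fin Q.numVars) (j : Fin Q.numAtoms) :
    Option (Fin (Q.arity (Q.rel j))) :=
  (st.pending j).filter fun k => Q.var j k = i

/-- The number of atoms that are handled at dimension `i`. -/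
def numActive (st : BoxState Q) (i : Fin Q.numVars) : ℕ :=
  (List.finRange Q.numAtoms).countP fun j => (active st i j).isSome

/-- The blocks for one atom if `mem` blocks are divided evenly among the atoms handled at
dimension `i`, but at least one block. -/
def share (st : BoxState Q) (i : Fin Q.numVars) (mem : ℕ) : ℕ := max 1 (mem / numActive st i)

variable (D : Database Q) (B : ℕ)

/-- The probe of atom `j` at dimension `i`, if it is handled there. -/
def probeAtom (st : BoxState Q) (i : Fin Q.numVars) (mem : ℕ) (j : Fin Q.numAtoms) :
    Option (Option ℕ∞ × List Step) :=
  (active st i j).map fun k =>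
    probe B (Q.rel j) (share st i mem) (D (Q.rel j)) k (startTuple st j)

/-- Atom `j` is spilled at dimension `i`. -/
def spilled (st : BoxState Q) (i : Fin Q.numVars) (mem : ℕ) (j : Fin Q.numAtoms) : Bool :=
  match probeAtom D B st i mem j with
  | some (none, _) => true
  | _ => false

/-- The upper bound at dimension `i`: the lower bound if some atom is spilled, and otherwise
the least of the probed bounds. -/
noncomputable def upperBound (st : BoxState Q) (i : Fin Q.numVars) (mem : ℕ) : ℕ∞ :=
  if (List.finRange Q.numAtoms).any (spilled D B st i mem) then (st.low i : ℕ∞)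
  else ((List.finRange Q.numAtoms).filterMap fun j =>
    (probeAtom D B st i mem j).bind Prod.fst).foldr min ⊤

/-- The level at which atom `j` is provisioned at dimension `i`, if it is. -/
def loaded (st : BoxState Q) (i : Fin Q.numVars) (mem : ℕ) (j : Fin Q.numAtoms) :
    Option (Fin (Q.arity (Q.rel j))) :=
  if spilled D B st i mem j then none else active st i j

/-- The slice of atom `j` at level `k` for the bounds found at dimension `i`. -/
noncomputable def newSlice (st : BoxState Q) (i : Fin Q.numVars) (mem : ℕ) (j : Fin Q.numAtoms)
    (k : Fin (Q.arity (Q.rel j))) : Finset (Fin (Q.arity (Q.rel j)) → ℕ) :=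
  slice (D (Q.rel j)) k (startTuple st j) (upperBound D B st i mem)

/-- The state after probing and provisioning at dimension `i`. A spilled atom is left
for the dimension of its next variable. -/
noncomputable def advance (st : BoxState Q) (i : Fin Q.numVars) (mem : ℕ) : BoxState Q where
  low := st.low
  high := Function.update st.high i (upperBound D B st i mem)
  pending := fun j =>
    match active st i j with
    | none => st.pending j
    | some k =>
        if spilled D B st i mem j then
          if h : (k : ℕ) + 1 < Q.arity (Q.rel j) then some ⟨k + 1, h⟩ else none
        else none
  slices := fun j =>
    match loaded D B st i mem j with
    | none => st.slices j
    | some k => newSlice D B st i mem j k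

/-- The I/Os of one round at dimension `i`: probe the atoms, then provision them or,
for the spilled ones, find the ends of the spilled value. -/
noncomputable def roundSteps (st : BoxState Q) (i : Fin Q.numVars) (mem : ℕ) : List Step :=
  ((List.finRange Q.numAtoms).flatMap fun j =>
    match probeAtom D B st i mem j with
    | none => []
    | some (_, tr) => tr) ++
  (List.finRange Q.numAtoms).flatMap fun j =>
    match active st i j with
    | none => []
    | some k =>
        if spilled D B st i mem j then
          locate B (Q.rel j) (D (Q.rel j)) k (startTuple st j)
        else
          provision B (Q.rel j) (D (Q.rel j)) k (startTuple st j) (upperBound D B st i mem)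

/-- The blocks of memory used by the slices provisioned in one round. -/
noncomputable def usedMem (st : BoxState Q) (i : Fin Q.numVars) (mem : ℕ) : ℕ :=
  ((List.finRange Q.numAtoms).map fun j =>
    match loaded D B st i mem j with
    | none => 0
    | some k => blocksFor B (words k (newSlice D B st i mem j k))).sum

/-- Drop the slices provisioned in one round. -/
noncomputable def releaseSteps (st : BoxState Q) (i : Fin Q.numVars) (mem : ℕ) : List Step :=
  (List.finRange Q.numAtoms).flatMap fun j =>
    match loaded D B st i mem j with
    | none => []
    | some k => [.io (.discard (words k (newSlice D B st i mem j k)))]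

/-- The repeat-until loop at dimension `i`: `body` does one round, including everything at later
dimensions, and returns its steps and the upper bound; the next lower bound is
the successor of the upper bound, and the loop ends with the upper bound `∞`.
The first argument bounds the number of rounds. -/
def repeatRounds (i : Fin Q.numVars) (body : BoxState Q → List Step × ℕ∞) :
    ℕ → BoxState Q → List Step
  | 0, _ => []
  | fuel + 1, st =>
      (body st).1 ++
        if (body st).2 = ⊤ then []
        else repeatRounds i body fuel
          { st with low := Function.update st.low i ((body st).2.toNat + 1) }

/-- The largest data value of the input. -/
def maxValue : ℕ := Finset.univ.sup fun r => (D r).sup fun x => Finset.univ.sup x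

/-- The procedure BoxUp, with the remaining dimensions, the memory left over by the
earlier dimensions, and the state. Each dimension has a budget of `budget` blocks. Since lower
bounds increase and the upper bound is `∞` as soon as the lower bound is larger than every data value,
a loop has at most `maxValue D + 2` rounds. -/
noncomputable def boxUp (budget : ℕ) : List (Fin Q.numVars) → ℕ → BoxState Q → List Step
  | [], _, st => runLFTJ st
  | i :: is, leftover, st =>
      repeatRounds i
        (fun st =>
          (roundSteps D B st i (budget + leftover) ++
            boxUp budget is (budget + leftover - usedMem D B st i (budget + leftover))
              (advance D B st i (budget + leftover)) ++
            releaseSteps D B st i (budget + leftover),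
          upperBound D B st i (budget + leftover)))
        (maxValue D + 2) { st with low := Function.update st.low i 0 }

/-- The initial state: the box is the whole space, and every atom has to be sliced at its
first level. -/
def initialState (Q : JoinQuery) : BoxState Q where
  low := fun _ => 0
  high := fun _ => ⊤
  pending := fun _ => some ⟨0, Q.arity_pos _⟩
  slices := fun _ => ∅

/-- The blocks of internal memory that are divided among the dimensions: all but one block for
the output buffer, `2 a` work blocks for probing and copying, and one block per atom for rounding. -/
def slicesMem (Q : JoinQuery) (M B : ℕ) : ℕ := M / B - (Q.numAtoms + 2 * Q.maxArity + 1)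

/-- Boxed Leapfrog Triejoin with `M` words of internal memory and blocks of `B` words:
the sequence of its I/O operations on the input `D`. The box boundaries and, for each atom and level,
the current positions in the arrays are kept in registers, whose number depends only on the query and
which are not counted as internal memory; a round starts at the positions where the last one ended. -/
noncomputable def boxedLFTJ (M : ℕ) : List Op :=
  bufferOutput B []
    (boxUp D B (slicesMem Q M B / Q.numVars) (List.finRange Q.numVars) 0 (initialState Q))

end LFTJ

end BoxedJoin

/-! Cost of the algorithm. A round at some dimension that does not reach the end of the domain is
stopped by an atom whose slice, extended by one more value, exceeds its share
(`exists_exceeding_of_upperBound`). A share times `B` is a fixed fraction of `M`, so this slice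
contains a number of tuples proportional to `M`. Their values lie in the interval just passed or
directly behind it, so each tuple column is charged at most twice in one loop. Whatever the earlier
dimensions have fixed, a loop therefore has at most `1 + O(|I|/M)` rounds (`mul_add_potential_le`,
`readCount_repeatRounds_le`). The hypothesis `M ≤ λ|I|` absorbs the `1`, and `n` nested loops have
`O((|I|/M)^n)` rounds altogether. A round reads `O(M/B)` blocks: slices are contiguous in every
array, and the binary search of a probe costs no logarithmic factor, because each read shrinks the
range of blocks between its two ends (`readCount_bisect_le`). The product is `|I|^n/(M^(n-1) B)`.
The `nK` output words pass through a buffer of one block, which adds at most `nK/B + 1` writes.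

Correctness. The intervals of a loop tile the domain, so each answer lies in exactly one box. A
spill sets the upper bound to the lower bound, so the variables of an atom before its current level
are fixed to single values, and one slice contains all tuples relevant for the box. This is kept as
`Invariant`; `listsOnce_boxUp` combines it with the correctness of Leapfrog Triejoin on a box.

Memory. The slices loaded in a round stay within the memory of the dimension, unless shares were
rounded up to one block. The excess is then at most one block per loaded atom, and an atom is loaded
at most once on each path through the nested loops, so one reserve block per atom suffices
(`usedMem_le`, `numPending_advance_add_le`, `runs_boxUp`).

Lower bound. A write moves at most `B` words, and for unary relations of nearly equal size the
product has `Ω(|I|^n)` tuples. -/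

namespace BoxedJoin

/-! ### Runs of step sequences -/

/-- The words appended to the output. -/
def emitted : List Step → List ℕ
  | [] => []
  | .io _ :: tr => emitted tr
  | .emit w :: tr => w :: emitted tr

/-- The number of block reads. -/
def readCount : List Step → ℕ
  | [] => 0
  | .io (.read _) :: tr => readCount tr + 1
  | _ :: tr => readCount tr

/-- `Runs B cap c tr c'`: the steps `tr`, which read, discard and emit only, take the internal memory
(without the output buffer) from `c` to `c'` occupied words, and read only within `cap` words. -/
inductive Runs (B cap : ℕ) : ℕ → List Step → ℕ → Prop
  | nil (c : ℕ) : Runs B cap c [] c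
  | read {c c' : ℕ} {tr : List Step} (ad : BlockAddr) (h : c + B ≤ cap)
      (ht : Runs B cap (c + B) tr c') : Runs B cap c (.io (.read ad) :: tr) c'
  | discard {c c' w : ℕ} {tr : List Step} (h : w ≤ c)
      (ht : Runs B cap (c - w) tr c') : Runs B cap c (.io (.discard w) :: tr) c'
  | emit {c c' : ℕ} {tr : List Step} (w : ℕ)
      (ht : Runs B cap c tr c') : Runs B cap c (.emit w :: tr) c'

@[simp] theorem emitted_append (l₁ l₂ : List Step) :
    emitted (l₁ ++ l₂) = emitted l₁ ++ emitted l₂ := by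
  induction l₁ with
  | nil => rfl
  | cons s l ih => cases s <;> simp [emitted, ih]

@[simp] theorem readCount_append (l₁ l₂ : List Step) :
    readCount (l₁ ++ l₂) = readCount l₁ + readCount l₂ := by
  induction l₁ with
  | nil => simp [readCount]
  | cons s l ih =>
    rcases s with (_ | _ | _ | _) | _ <;> simp [readCount, ih]; omega

theorem emitted_flatMap {α : Type*} (l : List α) (f : α → List Step) :
    emitted (l.flatMap f) = l.flatMap fun x => emitted (f x) := by
  induction l with
  | nil => rfl
  | cons x l ih => simp [ih]

theorem emitted_flatMap_eq_nil {α : Type*} (l : List α) (f : α → List Step)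
    (h : ∀ x ∈ l, emitted (f x) = []) : emitted (l.flatMap f) = [] := by
  rw [emitted_flatMap, List.flatMap_eq_nil_iff]
  exact h

theorem emitted_map_emit (l : List ℕ) : emitted (l.map Step.emit) = l := by
  induction l with
  | nil => rfl
  | cons x l ih => simp [emitted, ih]

theorem readCount_map_emit (l : List ℕ) : readCount (l.map Step.emit) = 0 := by
  induction l with
  | nil => rfl
  | cons x l ih => simp [readCount, ih]

theorem readCount_flatMap_le {α : Type*} (l : List α) (f : α → List Step) (b : ℕ)
    (h : ∀ x ∈ l, readCount (f x) ≤ b) : readCount (l.flatMap f) ≤ l.length * b := by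
  induction l with
  | nil => simp [readCount]
  | cons x l ih =>
    have h₁ := h x (by simp)
    have h₂ := ih fun y hy => h y (by simp [hy])
    simp only [List.flatMap_cons, readCount_append, List.length_cons, Nat.add_mul]
    omega

section Runs

variable {B cap : ℕ}

theorem Runs.append {c c₁ c₂ : ℕ} {l₁ l₂ : List Step} (h₁ : Runs B cap c l₁ c₁)
    (h₂ : Runs B cap c₁ l₂ c₂) : Runs B cap c (l₁ ++ l₂) c₂ := by
  induction h₁ with
  | nil => exact h₂
  | read ad h _ ih => exact .read ad h (ih h₂)
  | discard h _ ih => exact .discard h (ih h₂)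
  | emit w _ ih => exact .emit w (ih h₂)

theorem Runs.flatMap_add {α : Type*} (l : List α) (f : α → List Step) (g : α → ℕ) (extra : ℕ)
    (h : ∀ x ∈ l, ∀ c, c + g x + extra ≤ cap → Runs B cap c (f x) (c + g x)) {c : ℕ}
    (hc : c + (l.map g).sum + extra ≤ cap) :
    Runs B cap c (l.flatMap f) (c + (l.map g).sum) := by
  induction l generalizing c with
  | nil => exact .nil c
  | cons x l ih =>
    simp only [List.map_cons, List.sum_cons] at hc ⊢
    rw [List.flatMap_cons, ← Nat.add_assoc]
    exact (h x (by simp) c (by omega)).append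
      (ih (fun y hy => h y (by simp [hy])) (by omega))

theorem Runs.flatMap_const {α : Type*} (l : List α) (f : α → List Step) {c : ℕ}
    (h : ∀ x ∈ l, Runs B cap c (f x) c) : Runs B cap c (l.flatMap f) c := by
  induction l with
  | nil => exact .nil c
  | cons x l ih =>
    exact (h x (by simp)).append (ih fun y hy => h y (by simp [hy]))

theorem Runs.flatMap_sub {α : Type*} (l : List α) (f : α → List Step) (g : α → ℕ)
    (h : ∀ x ∈ l, ∀ c, Runs B cap (c + g x) (f x) c) (c : ℕ) :
    Runs B cap (c + (l.map g).sum) (l.flatMap f) c := by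
  induction l with
  | nil => exact .nil c
  | cons x l ih =>
    rw [List.flatMap_cons, List.map_cons, List.sum_cons, Nat.add_comm (g x), ← Nat.add_assoc]
    exact (h x (by simp) _).append (ih fun y hy => h y (by simp [hy]))

theorem Runs.map_emit (l : List ℕ) (c : ℕ) : Runs B cap c (l.map Step.emit) c := by
  induction l with
  | nil => exact .nil c
  | cons w l ih => exact .emit w ih

theorem Runs.map_read {α : Type*} (l : List α) (f : α → BlockAddr) {c : ℕ}
    (h : c + l.length * B ≤ cap) :
    Runs B cap c (l.map fun b => Step.io (.read (f b))) (c + l.length * B) := by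
  induction l generalizing c with
  | nil => simpa using Runs.nil c
  | cons b l ih =>
    rw [List.length_cons, Nat.succ_mul] at h ⊢
    have := ih (c := c + B) (by omega)
    rw [show c + (l.length * B + B) = c + B + l.length * B by omega]
    exact .read _ (by omega) this

/-! ### The output buffer -/

/-- Between steps the buffer holds fewer than `B` words, and the word that fills it is followed at
once by the write that empties it. One block beyond `cap` therefore suffices. -/
theorem Runs.admissible_bufferOutput {M c : ℕ} {tr : List Step} (hB : 1 ≤ B)
    (hM : cap + B ≤ M) (h : Runs B cap c tr 0) (hc : c ≤ cap) (buf : List ℕ)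
    (hb : buf.length < B) : Admissible M B (c + buf.length) (bufferOutput B buf tr) := by
  generalize he : (0 : ℕ) = e at h
  induction h generalizing buf with
  | nil c =>
    cases buf with
    | nil => simp only [bufferOutput, Admissible]; omega
    | cons w buf =>
      simp only [List.length_cons] at hb
      simp only [bufferOutput, Admissible, List.length_cons]; omega
  | read ad h _ ih =>
    simp only [bufferOutput, Admissible]
    refine ⟨by omega, ?_⟩
    rw [Nat.add_right_comm]
    exact ih h buf hb he
  | @discard c c' w tr h _ ih =>
    simp only [bufferOutput, Admissible]
    refine ⟨by omega, ?_⟩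
    rw [Nat.sub_add_comm h]
    exact ih (by omega) buf hb he
  | emit w _ ih =>
    rw [bufferOutput]
    split_ifs with hl
    · simp only [Admissible, List.length_append, List.length_singleton]
      refine ⟨by omega, by omega, by omega, ?_⟩
      have := ih hc [] hB he
      convert this using 1
      simp
    · simp only [Admissible]
      refine ⟨by omega, ?_⟩
      have := ih hc (buf ++ [w]) (by simp; omega) he
      simpa [Nat.add_assoc] using this

theorem Runs.written_bufferOutput {c c' : ℕ} {tr : List Step} (h : Runs B cap c tr c')
    (buf : List ℕ) : written (bufferOutput B buf tr) = buf ++ emitted tr := by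
  induction h generalizing buf with
  | nil c => cases buf <;> simp [bufferOutput, written, emitted]
  | read ad h _ ih => simp [bufferOutput, written, emitted, ih]
  | discard h _ ih => simp [bufferOutput, written, emitted, ih]
  | emit w _ ih =>
    rw [bufferOutput]
    split_ifs with hl <;> simp [written, emitted, ih]

/-- Amortization: every emitted word carries one unit of credit, and a full buffer has collected the
`B` units that its write costs. The final `B` pays for the last, partially filled block. -/
theorem Runs.ioCost_bufferOutput_le {c c' : ℕ} {tr : List Step} (h : Runs B cap c tr c')
    (buf : List ℕ) :
    B * ioCost (bufferOutput B buf tr) ≤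
      B * readCount tr + (buf.length + (emitted tr).length) + B := by
  induction h generalizing buf with
  | nil c => cases buf <;> simp [bufferOutput, ioCost, emitted, readCount]
  | read ad h _ ih =>
    have := ih buf
    simp only [bufferOutput, ioCost, emitted, readCount, Nat.mul_add]
    omega
  | discard h _ ih => simpa only [bufferOutput, ioCost, emitted, readCount] using ih buf
  | emit w _ ih =>
    rw [bufferOutput]
    split_ifs with hl
    · have := ih []
      simp only [ioCost, emitted, readCount, Nat.mul_add, List.length_cons, List.length_nil]
        at this ⊢
      omega
    · have := ih (buf ++ [w])
      simp only [ioCost, emitted, readCount, List.length_cons, List.length_nil,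
        List.length_append] at this ⊢
      omega

end Runs

/-! ### Slices and their sizes -/

section Trie

variable {a : ℕ}

theorem width_mono {S S' : Finset (Fin a → ℕ)} (h : S ⊆ S') (j : ℕ) : width S j ≤ width S' j :=
  Finset.card_le_card (Finset.image_subset_image h)

theorem idxLength_mono {S S' : Finset (Fin a → ℕ)} (h : S ⊆ S') (j : ℕ) :
    idxLength S j ≤ idxLength S' j := by
  unfold idxLength
  split_ifs with h₁ h₂
  · exact Nat.succ_le_succ (width_mono h j)
  · exact absurd (h₁.mono h) h₂
  · omega
  · exact le_rfl

theorem words_mono (k : ℕ) {S S' : Finset (Fin a → ℕ)} (h : S ⊆ S') : words k S ≤ words k S' :=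
  Nat.add_le_add (Finset.sum_le_sum fun j _ => width_mono h j)
    (Finset.sum_le_sum fun j _ => idxLength_mono h j)

theorem width_le_card (S : Finset (Fin a → ℕ)) (j : ℕ) : width S j ≤ S.card :=
  Finset.card_image_le

theorem idxLength_le_card (S : Finset (Fin a → ℕ)) (j : ℕ) : idxLength S j ≤ 2 * S.card := by
  unfold idxLength
  split_ifs with h
  · have := width_le_card S j
    have := h.card_pos
    omega
  · omega

/-- Turns an exceeded memory share into a number of tuples. At most `a` arrays of each kind are
stored; a value array counts once and an index array, with its extra entry, at most twice. -/
theorem words_le_card (k : ℕ) (S : Finset (Fin a → ℕ)) : words k S ≤ 3 * a * S.card := by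
  have h₁ : ∑ j ∈ Finset.Ico k a, width S j ≤ a * S.card := by
    refine (Finset.sum_le_card_nsmul _ _ _ fun j _ => width_le_card S j).trans ?_
    rw [smul_eq_mul, Nat.card_Ico]
    exact Nat.mul_le_mul_right _ (by omega)
  have h₂ : ∑ j ∈ Finset.Ico k (a - 1), idxLength S j ≤ a * (2 * S.card) := by
    refine (Finset.sum_le_card_nsmul _ _ _ fun j _ => idxLength_le_card S j).trans ?_
    rw [smul_eq_mul, Nat.card_Ico]
    exact Nat.mul_le_mul_right _ (by omega)
  unfold words
  linarith

theorem width_le_words {k j : ℕ} (hk : k ≤ j) (hj : j < a) (S : Finset (Fin a → ℕ)) :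
    width S j ≤ words k S :=
  (Finset.single_le_sum (f := fun j => width S j) (fun _ _ => Nat.zero_le _)
    (Finset.mem_Ico.2 ⟨hk, hj⟩)).trans (Nat.le_add_right _ _)

theorem idxLength_le_words {k j : ℕ} (hk : k ≤ j) (hj : j < a - 1) (S : Finset (Fin a → ℕ)) :
    idxLength S j ≤ words k S :=
  (Finset.single_le_sum (f := fun j => idxLength S j) (fun _ _ => Nat.zero_le _)
    (Finset.mem_Ico.2 ⟨hk, hj⟩)).trans (Nat.le_add_left _ _)

theorem blocksFor_le_iff {B w m : ℕ} (hB : 1 ≤ B) : blocksFor B w ≤ m ↔ w ≤ m * B := by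
  unfold blocksFor
  rw [← Nat.lt_succ_iff, Nat.div_lt_iff_lt_mul hB, Nat.succ_mul]
  omega

theorem le_blocksFor_mul {B : ℕ} (hB : 1 ≤ B) (w : ℕ) : w ≤ blocksFor B w * B :=
  (blocksFor_le_iff hB).1 le_rfl

theorem slice_mono (R : Finset (Fin a → ℕ)) (k : Fin a) (t : Fin a → ℕ) {h h' : ℕ∞}
    (hh : h ≤ h') : slice R k t h ⊆ slice R k t h' := by
  intro x
  simp only [slice, Finset.mem_filter]
  exact fun ⟨h₁, h₂, h₃, h₄⟩ => ⟨h₁, h₂, h₃, h₄.trans hh⟩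

theorem take_succ_ofFn_eq {R : Finset (Fin a → ℕ)} {k : Fin a} {t : Fin a → ℕ} {h : ℕ∞}
    {x : Fin a → ℕ} (hx : x ∈ slice R k t h) :
    (List.ofFn x).take (k + 1) = (List.ofFn t).take k ++ [x k] := by
  simp only [slice, Finset.mem_filter] at hx
  have hk := k.2
  apply List.ext_getElem
  · simp
  · intro i h₁ h₂
    simp only [List.length_take, List.length_ofFn] at h₁
    rcases Nat.lt_or_ge i k with hi | hi
    · rw [List.getElem_append_left (by simp; omega)]
      simpa using hx.2.1 ⟨i, by omega⟩ hi
    · have : i = k := by omega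
      subst this
      rw [List.getElem_append_right (by simp)]
      simp

/-- The first `k` components are constant on a slice, so a trie node at level `k` is determined by
its last component. -/
theorem width_slice_le (R : Finset (Fin a → ℕ)) (k : Fin a) (t : Fin a → ℕ) {h : ℕ∞}
    {S : Finset (Fin a → ℕ)} (hS : S ⊆ slice R k t h) :
    width S k ≤ (S.image fun x => x k).card := by
  have : nodes S k ⊆ (S.image fun x => x k).image fun v => (List.ofFn t).take k ++ [v] := by
    intro l hl
    obtain ⟨x, hx, rfl⟩ := Finset.mem_image.1 hl
    rw [take_succ_ofFn_eq (hS hx)]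
    exact Finset.mem_image_of_mem _ (Finset.mem_image_of_mem _ hx)
  exact (Finset.card_le_card this).trans Finset.card_image_le

theorem length_children (R : Finset (Fin a → ℕ)) (k : Fin a) (t : Fin a → ℕ) :
    (children R k t).length = ((slice R k t ⊤).image fun x => x k).card :=
  Finset.length_sort _

theorem width_slice_le_length_children (R : Finset (Fin a → ℕ)) (k : Fin a) (t : Fin a → ℕ)
    (h : ℕ∞) : width (slice R k t h) k ≤ (children R k t).length := by
  rw [length_children]
  exact (width_slice_le R k t subset_rfl).trans
    (Finset.card_le_card (Finset.image_subset_image (slice_mono R k t le_top)))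

theorem headSlice_zero (R : Finset (Fin a → ℕ)) (k : Fin a) (t : Fin a → ℕ) :
    headSlice R k t 0 = ∅ := by
  simp [headSlice]

theorem words_empty (k : ℕ) : words k (∅ : Finset (Fin a → ℕ)) = 0 := by
  simp [words, width, nodes, idxLength]

theorem mem_children {R : Finset (Fin a → ℕ)} {k : Fin a} {t : Fin a → ℕ} {v : ℕ} :
    v ∈ children R k t ↔ ∃ x ∈ slice R k t ⊤, x k = v := by
  simp [children]

theorem children_strictMono (R : Finset (Fin a → ℕ)) (k : Fin a) (t : Fin a → ℕ) :
    StrictMono (children R k t).get :=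
  (Finset.sortedLT_sort _).strictMono_get

theorem mem_take_children_iff {R : Finset (Fin a → ℕ)} {k : Fin a} {t : Fin a → ℕ} {v s : ℕ}
    (hv : v ∈ children R k t) (hs : s < (children R k t).length) :
    v ∈ (children R k t).take s ↔ v < (children R k t)[s] := by
  obtain ⟨i, hi, rfl⟩ := List.getElem_of_mem hv
  have hm := (children_strictMono R k t).lt_iff_lt (a := ⟨i, hi⟩) (b := ⟨s, hs⟩)
  simp only [List.get_eq_getElem, Fin.mk_lt_mk] at hm
  rw [hm, List.mem_take_iff_getElem]
  constructor
  · rintro ⟨j, hj, hji⟩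
    have := (children_strictMono R k t).injective (a₁ := ⟨j, by omega⟩) (a₂ := ⟨i, hi⟩)
      (by simpa using hji)
    simp only [Fin.mk.injEq] at this
    omega
  · intro h
    exact ⟨i, by omega, rfl⟩

theorem mem_take_succ_children_iff {R : Finset (Fin a → ℕ)} {k : Fin a} {t : Fin a → ℕ} {v s : ℕ}
    (hv : v ∈ children R k t) (hs : s < (children R k t).length) :
    v ∈ (children R k t).take (s + 1) ↔ v ≤ (children R k t)[s] := by
  rw [List.take_succ_eq_append_getElem hs, List.mem_append, mem_take_children_iff hv hs,
    List.mem_singleton]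
  omega

/-- With `headSlice_succ_subset_slice`, this translates between slices bounded by a value, as the
boxes need them, and slices bounded by a number of values, which the binary search handles. -/
theorem slice_subset_headSlice {R : Finset (Fin a → ℕ)} {k : Fin a} {t : Fin a → ℕ} {s h : ℕ}
    (hs : s < (children R k t).length) (hh : h < (children R k t)[s]) :
    slice R k t h ⊆ headSlice R k t s := by
  intro x hx
  have hx' := slice_mono R k t le_top hx
  refine Finset.mem_filter.2 ⟨hx', ?_⟩
  rw [mem_take_children_iff (mem_children.2 ⟨x, hx', rfl⟩) hs]
  have := (Finset.mem_filter.1 hx).2.2.2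
  exact lt_of_le_of_lt (by exact_mod_cast this) hh

theorem headSlice_succ_subset_slice {R : Finset (Fin a → ℕ)} {k : Fin a} {t : Fin a → ℕ} {s : ℕ}
    (hs : s < (children R k t).length) :
    headSlice R k t (s + 1) ⊆ slice R k t ((children R k t)[s] : ℕ) := by
  intro x hx
  obtain ⟨hx, hv⟩ := Finset.mem_filter.1 hx
  rw [mem_take_succ_children_iff (mem_children.2 ⟨x, hx, rfl⟩) hs] at hv
  have := (Finset.mem_filter.1 hx)
  exact Finset.mem_filter.2 ⟨this.1, this.2.1, this.2.2.1, by exact_mod_cast hv⟩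

theorem headSlice_length (R : Finset (Fin a → ℕ)) (k : Fin a) (t : Fin a → ℕ) :
    headSlice R k t (children R k t).length = slice R k t ⊤ := by
  rw [headSlice, List.take_length, Finset.filter_true_of_mem]
  exact fun x hx => mem_children.2 ⟨x, hx, rfl⟩

theorem headSlice_mono (R : Finset (Fin a → ℕ)) (k : Fin a) (t : Fin a → ℕ) {u u' : ℕ}
    (h : u ≤ u') : headSlice R k t u ⊆ headSlice R k t u' := by
  intro x hx
  obtain ⟨hx, hv⟩ := Finset.mem_filter.1 hx
  exact Finset.mem_filter.2 ⟨hx, List.take_subset_take_left _ h hv⟩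

/-- At the last level, the slice of a single value fits into one word. -/
theorem words_slice_self_le (R : Finset (Fin a → ℕ)) (k : Fin a) (t : Fin a → ℕ)
    (hk : a ≤ k + 1) : words k (slice R k t (t k)) ≤ 1 := by
  have hk' := k.2
  have h₁ : Finset.Ico (k : ℕ) a = {(k : ℕ)} := by
    ext j; simp only [Finset.mem_Ico, Finset.mem_singleton]; omega
  have h₂ : Finset.Ico (k : ℕ) (a - 1) = ∅ := Finset.Ico_eq_empty (by omega)
  rw [words, h₁, h₂, Finset.sum_singleton, Finset.sum_empty, Nat.add_zero]
  refine (width_slice_le R k t subset_rfl).trans ?_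
  refine Finset.card_le_one.2 fun u hu v hv => ?_
  have key : ∀ w ∈ (slice R k t (t k)).image fun x => x k, w = t k := by
    intro w hw
    obtain ⟨x, hx, rfl⟩ := Finset.mem_image.1 hw
    have := (Finset.mem_filter.1 hx).2.2
    exact le_antisymm (by exact_mod_cast this.2) this.1
  rw [key u hu, key v hv]

/-! ### Probing -/

variable {B r m : ℕ} {R : Finset (Fin a → ℕ)} {k : Fin a} {t : Fin a → ℕ}

theorem fits_zero (hB : 1 ≤ B) : Fits B m R k t 0 := by
  rw [Fits, blocksFor_le_iff hB, headSlice_zero, words_empty]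
  exact Nat.zero_le _

/-- The search keeps `lo` fitting and `hi` not fitting, and stops when they are adjacent. -/
theorem bisect_spec {lo hi : ℕ} (h : lo < hi) (hlo : Fits B m R k t lo)
    (hhi : ¬ Fits B m R k t hi) :
    (bisect B r m R k t lo hi).1 < hi ∧ Fits B m R k t (bisect B r m R k t lo hi).1 ∧
      ¬ Fits B m R k t ((bisect B r m R k t lo hi).1 + 1) := by
  induction hn : hi - lo using Nat.strong_induction_on generalizing lo hi with
  | _ n ih =>
    rw [bisect]
    split_ifs with h₁ h₂
    · have : hi = lo + 1 := by omega
      subst this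
      exact ⟨h, hlo, hhi⟩
    · exact ih (hi - (lo + hi) / 2) (by omega) (by omega) h₂ hhi rfl
    · obtain ⟨h₃, h₄⟩ := ih ((lo + hi) / 2 - lo) (by omega) (by omega) hlo h₂ rfl
      exact ⟨h₃.trans (by omega), h₄⟩

theorem probe_fst (B r m : ℕ) (R : Finset (Fin a → ℕ)) (k : Fin a) (t : Fin a → ℕ) :
    (probe B r m R k t).1 =
      if Fits B m R k t (children R k t).length then some ⊤
      else if (children R k t).getD (bisect B r m R k t 0 (children R k t).length).1 0 = t k
        then none
        else some (((children R k t).getD (bisect B r m R k t 0 (children R k t).length).1 0 - 1 :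
          ℕ) : ℕ∞) := by
  unfold probe
  by_cases h : Fits B m R k t (children R k t).length
  · simp only [h, if_true]
  · simp only [h, if_false]

/-- The three outcomes of probing. -/
theorem probe_cases (hB : 1 ≤ B) (r m : ℕ) (R : Finset (Fin a → ℕ)) (k : Fin a)
    (t : Fin a → ℕ) :
    ((probe B r m R k t).1 = some ⊤ ∧ words k (slice R k t ⊤) ≤ m * B) ∨
    (∃ h : ℕ, (probe B r m R k t).1 = some (h : ℕ∞) ∧ t k ≤ h ∧
      words k (slice R k t h) ≤ m * B ∧ m * B < words k (slice R k t ((h + 1 : ℕ) : ℕ∞))) ∨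
    ((probe B r m R k t).1 = none ∧ m * B < words k (slice R k t (t k))) := by
  rw [probe_fst]
  by_cases hN : Fits B m R k t (children R k t).length
  · rw [if_pos hN]
    refine .inl ⟨rfl, ?_⟩
    rwa [Fits, blocksFor_le_iff hB, headSlice_length] at hN
  rw [if_neg hN]
  have hpos : 0 < (children R k t).length := by
    by_contra h
    rw [Nat.eq_zero_of_not_pos h] at hN
    exact hN (fits_zero hB)
  obtain ⟨hs, hf, hnf⟩ := bisect_spec (r := r) hpos (fits_zero hB) hN
  set s := (bisect B r m R k t 0 (children R k t).length).1
  rw [Fits, blocksFor_le_iff hB] at hf hnf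
  rw [List.getD_eq_getElem _ _ hs]
  have hlt := (not_le.1 hnf).trans_le (words_mono k (headSlice_succ_subset_slice hs))
  -- Child number `s` is the first value that no longer fits. If it is `t k`, not even that single
  -- value fits; otherwise the bound is one below the child, possibly with an empty slice.
  split_ifs with hc
  · refine .inr (.inr ⟨rfl, ?_⟩)
    rwa [hc] at hlt
  · have hge : t k ≤ (children R k t)[s] := by
      obtain ⟨x, hx, hxv⟩ := mem_children.1 (List.getElem_mem hs)
      rw [← hxv]
      exact (Finset.mem_filter.1 hx).2.2.1
    refine .inr (.inl ⟨_, rfl, by omega, ?_, ?_⟩)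
    · exact (words_mono k (slice_subset_headSlice hs (by omega))).trans hf
    · rwa [Nat.sub_add_cancel (by omega)]

theorem endBlock_mono {j u u' : ℕ} (h : u ≤ u') :
    endBlock B m R k t j u ≤ endBlock B m R k t j u' := by
  unfold endBlock
  exact Nat.div_le_div_right (Nat.add_le_add_left
    (min_le_min_right _ (width_mono (headSlice_mono R k t h) j)) _)

/-- The cutoff at `m * B` entries in `endBlock` keeps the search range within `m` blocks even if the
whole relation is far larger. -/
theorem endBlock_le (hB : 1 ≤ B) (j u : ℕ) :
    endBlock B m R k t j u ≤ endBlock B m R k t j 0 + m := by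
  unfold endBlock
  rw [headSlice_zero]
  have : width (∅ : Finset (Fin a → ℕ)) j = 0 := by simp [width, nodes]
  rw [this, Nat.zero_min, Nat.add_zero, ← Nat.add_mul_div_right _ _ hB]
  exact Nat.div_le_div_right (Nat.add_le_add_left (min_le_right _ _) _)

@[simp] theorem readCount_peek (kind : ArrayKind) (j b : ℕ) :
    readCount (peek B r kind j b) = 1 := rfl

theorem runs_peek {cap c : ℕ} (kind : ArrayKind) (j b : ℕ) (h : c + B ≤ cap) :
    Runs B cap c (peek B r kind j b) c := by
  refine .read _ h (.discard (by omega) ?_)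
  rw [Nat.add_sub_cancel]
  exact .nil c

/-- A block is read only if it lies strictly between the two end blocks. Whichever half the search
continues with, the gap at that level then shrinks by at least one, which pays for the read. -/
theorem readCount_guessReads_add_le {lo u hi : ℕ} (h₁ : lo ≤ u) (h₂ : u ≤ hi) :
    readCount (guessReads B r m R k t lo u hi) +
        max (((List.range' k (a - 1 - k)).map fun j =>
            endBlock B m R k t j hi - endBlock B m R k t j u).sum)
          (((List.range' k (a - 1 - k)).map fun j =>
            endBlock B m R k t j u - endBlock B m R k t j lo).sum) ≤
      ((List.range' k (a - 1 - k)).map fun j =>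
        endBlock B m R k t j hi - endBlock B m R k t j lo).sum := by
  unfold guessReads
  induction List.range' (k : ℕ) (a - 1 - k) with
  | nil => simp [readCount]
  | cons j l ih =>
    have m₁ := endBlock_mono (B := B) (m := m) (R := R) (k := k) (t := t) (j := j) h₁
    have m₂ := endBlock_mono (B := B) (m := m) (R := R) (k := k) (t := t) (j := j) h₂
    simp only [List.flatMap_cons, readCount_append, List.map_cons, List.sum_cons]
    split_ifs with h
    · simp only [readCount]
      omega
    · rw [not_or] at h
      rw [readCount_peek]
      omega

/-- The gaps between the end blocks serve as a potential, so the reads telescope and the bound is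
free of the number of bisection steps. -/
theorem readCount_bisect_le {lo hi : ℕ} (h : lo ≤ hi) :
    readCount (bisect B r m R k t lo hi).2 ≤
      ((List.range' k (a - 1 - k)).map fun j =>
        endBlock B m R k t j hi - endBlock B m R k t j lo).sum := by
  induction hn : hi - lo using Nat.strong_induction_on generalizing lo hi with
  | _ n ih =>
    have hg := readCount_guessReads_add_le (B := B) (r := r) (m := m) (R := R) (k := k) (t := t)
      (lo := lo) (u := (lo + hi) / 2) (hi := hi) (by omega) (by omega)
    rw [bisect]
    split_ifs with h₁ h₂
    · simp [readCount]
    · have := ih (hi - (lo + hi) / 2) (by omega) (lo := (lo + hi) / 2) (hi := hi) (by omega) rfl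
      rw [readCount_append]
      omega
    · have := ih ((lo + hi) / 2 - lo) (by omega) (lo := lo) (hi := (lo + hi) / 2) (by omega) rfl
      rw [readCount_append]
      omega

theorem emitted_guessReads (lo u hi : ℕ) : emitted (guessReads B r m R k t lo u hi) = [] := by
  refine emitted_flatMap_eq_nil _ _ fun j _ => ?_
  split_ifs <;> rfl

theorem emitted_bisect (lo hi : ℕ) : emitted (bisect B r m R k t lo hi).2 = [] := by
  induction hn : hi - lo using Nat.strong_induction_on generalizing lo hi with
  | _ n ih =>
    rw [bisect]
    split_ifs with h₁ h₂
    · rfl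
    · rw [emitted_append, emitted_guessReads, ih _ (by omega) _ _ rfl, List.nil_append]
    · rw [emitted_append, emitted_guessReads, ih _ (by omega) _ _ rfl, List.nil_append]

theorem runs_bisect {cap c : ℕ} (h : c + B ≤ cap) (lo hi : ℕ) :
    Runs B cap c (bisect B r m R k t lo hi).2 c := by
  have hg : ∀ lo u hi, Runs B cap c (guessReads B r m R k t lo u hi) c := by
    intro lo u hi
    refine Runs.flatMap_const _ _ fun j _ => ?_
    split_ifs
    · exact .nil c
    · exact runs_peek _ _ _ h
  induction hn : hi - lo using Nat.strong_induction_on generalizing lo hi with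
  | _ n ih =>
    rw [bisect]
    split_ifs with h₁ h₂
    · exact .nil c
    · exact (hg _ _ _).append (ih _ (by omega) _ _ rfl)
    · exact (hg _ _ _).append (ih _ (by omega) _ _ rfl)

theorem probe_snd (B r m : ℕ) (R : Finset (Fin a → ℕ)) (k : Fin a) (t : Fin a → ℕ) :
    ∃ mid : List Step,
      (probe B r m R k t).2 =
        ((List.range' (k : ℕ) (a - 1 - k)).flatMap fun j =>
          [.io (.read ⟨r, .idx, j, endBlock B m R k t j 0⟩),
            .io (.read ⟨r, .idx, j, endBlock B m R k t j (children R k t).length⟩)]) ++ mid ++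
          [.io (.discard (2 * (a - 1 - k) * B))] ∧
      (mid = [] ∨ ∃ b, mid = (bisect B r m R k t 0 (children R k t).length).2 ++
        peek B r .val k b) := by
  unfold probe
  by_cases h : Fits B m R k t (children R k t).length
  · exact ⟨[], by simp only [h, if_true, List.length_range', List.append_nil], .inl rfl⟩
  · exact ⟨_, by simp only [h, if_false, List.length_range', List.append_assoc], .inr
      ⟨(startPos R k t k + (bisect B r m R k t 0 (children R k t).length).1) / B, rfl⟩⟩

theorem emitted_probe : emitted (probe B r m R k t).2 = [] := by
  obtain ⟨mid, h, hm⟩ := probe_snd B r m R k t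
  rw [h, emitted_append, emitted_append, emitted_flatMap_eq_nil _ _ fun j _ => rfl]
  rcases hm with rfl | ⟨b, rfl⟩
  · rfl
  · rw [emitted_append, emitted_bisect]
    rfl

theorem readCount_probe_le (hB : 1 ≤ B) (r m : ℕ) (R : Finset (Fin a → ℕ)) (k : Fin a)
    (t : Fin a → ℕ) : readCount (probe B r m R k t).2 ≤ a * (m + 2) + 1 := by
  obtain ⟨mid, h, hm⟩ := probe_snd B r m R k t
  have h₁ := readCount_flatMap_le (List.range' (k : ℕ) (a - 1 - k)) (fun j =>
    [Step.io (.read ⟨r, .idx, j, endBlock B m R k t j 0⟩),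
      .io (.read ⟨r, .idx, j, endBlock B m R k t j (children R k t).length⟩)]) 2
    (fun j _ => le_rfl)
  have h₂ : readCount mid ≤ (a - 1 - k) * m + 1 := by
    rcases hm with rfl | ⟨b, rfl⟩
    · exact Nat.zero_le _
    · rw [readCount_append, readCount_peek]
      refine Nat.add_le_add_right ((readCount_bisect_le (Nat.zero_le _)).trans ?_) 1
      refine (List.sum_le_card_nsmul _ m ?_).trans (by simp)
      intro n hn
      obtain ⟨j, -, rfl⟩ := List.mem_map.1 hn
      have := endBlock_le (m := m) (R := R) (k := k) (t := t) hB j (children R k t).length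
      omega
  have h₃ : (a - 1 - k) * (m + 2) ≤ a * (m + 2) := Nat.mul_le_mul_right _ (by omega)
  rw [h, readCount_append, readCount_append]
  rw [List.length_range'] at h₁
  rw [Nat.mul_add] at h₃
  have h₄ : readCount [Step.io (.discard (2 * (a - 1 - k) * B))] = 0 := rfl
  omega

theorem runs_probe {cap c : ℕ} (h : c + 2 * a * B ≤ cap) :
    Runs B cap c (probe B r m R k t).2 c := by
  obtain ⟨mid, h₀, hm⟩ := probe_snd B r m R k t
  have hk := k.2
  -- Two end blocks for each of the `a - 1 - k` index arrays, and one more block for a peek.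
  have hab : (2 * (a - 1 - k) + 1) * B ≤ 2 * a * B := Nat.mul_le_mul_right _ (by omega)
  rw [Nat.add_mul, Nat.one_mul] at hab
  rw [h₀]
  have hsum : ((List.range' (k : ℕ) (a - 1 - k)).map fun _ => 2 * B).sum =
      2 * (a - 1 - k) * B := by
    rw [List.map_const', List.sum_replicate, List.length_range', smul_eq_mul]
    ring
  refine Runs.append (c₁ := c + 2 * (a - 1 - k) * B)
    (Runs.append (c₁ := c + 2 * (a - 1 - k) * B) ?_ ?_) ?_
  · rw [← hsum]
    refine Runs.flatMap_add _ _ _ 0 (fun j _ c hc => ?_) (by omega)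
    refine .read _ (by omega) (.read _ (by omega) ?_)
    rw [Nat.add_assoc, ← Nat.two_mul]
    exact .nil _
  · rcases hm with rfl | ⟨b, rfl⟩
    · exact .nil _
    · exact (runs_bisect (by omega) _ _).append (runs_peek _ _ _ (by omega))
  · refine .discard (by omega) ?_
    rw [Nat.add_sub_cancel]
    exact .nil _

/-! ### Provisioning -/

theorem le_length_spanned_mul (hB : 1 ≤ B) (p len : ℕ) :
    len ≤ (spanned B p len).length * B := by
  unfold spanned
  split_ifs with h
  · simp [h]
  · have h₁ := Nat.div_mul_le_self p B
    have h₂ := Nat.lt_div_mul_add (a := p + len - 1) hB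
    have h₃ : p / B ≤ (p + len - 1) / B := Nat.div_le_div_right (by omega)
    rw [List.length_range', Nat.add_mul, Nat.sub_mul, Nat.one_mul]
    omega

/-- Only the first and the last block can be partly outside the range. The spare word on the left
lets `runs_copyRange` inspect one entry more than it keeps. -/
theorem length_spanned_mul_le (hB : 1 ≤ B) (p len : ℕ) :
    (spanned B p len).length * B + 1 ≤ len + 2 * B := by
  unfold spanned
  split_ifs with h
  · simp; omega
  · have h₁ := Nat.div_mul_le_self (p + len - 1) B
    have h₂ := Nat.lt_div_mul_add (a := p) hB
    rw [List.length_range', Nat.add_mul, Nat.sub_mul, Nat.one_mul]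
    omega

theorem emitted_copyRange (kind : ArrayKind) (j p len keep : ℕ) :
    emitted (copyRange B r kind j p len keep) = [] := by
  rw [copyRange, emitted_append, List.map_eq_flatMap,
    emitted_flatMap_eq_nil _ _ fun _ _ => rfl]
  rfl

theorem readCount_copyRange (kind : ArrayKind) (j p len keep : ℕ) :
    readCount (copyRange B r kind j p len keep) ≤ (spanned B p len).length := by
  have := readCount_flatMap_le (spanned B p len)
    (fun b => [Step.io (.read ⟨r, kind, j, b⟩)]) 1 fun _ _ => le_rfl
  rw [copyRange, readCount_append, List.map_eq_flatMap]
  simpa [readCount] using this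

theorem runs_copyRange (hB : 1 ≤ B) {cap c : ℕ} (kind : ArrayKind) (j p : ℕ) {len keep : ℕ}
    (h₁ : keep ≤ len) (h₂ : len ≤ keep + 1) (h : c + keep + 2 * B ≤ cap) :
    Runs B cap c (copyRange B r kind j p len keep) (c + keep) := by
  have hl := le_length_spanned_mul hB p len
  have hu := length_spanned_mul_le hB p len
  refine (Runs.map_read _ _ (by omega)).append (.discard (by omega) ?_)
  rw [show c + (spanned B p len).length * B - ((spanned B p len).length * B - keep) = c + keep
    by omega]
  exact .nil _

theorem valLength_bounds (R : Finset (Fin a → ℕ)) (k : Fin a) (t : Fin a → ℕ) (h : ℕ∞) (j : ℕ) :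
    width (slice R k t h) j ≤ (if j = k then min (width (slice R k t h) j + 1)
        (children R k t).length else width (slice R k t h) j) ∧
      (if j = k then min (width (slice R k t h) j + 1)
        (children R k t).length else width (slice R k t h) j) ≤ width (slice R k t h) j + 1 := by
  split_ifs with hj
  · subst hj
    have := width_slice_le_length_children R k t h
    omega
  · omega

theorem emitted_provision (h : ℕ∞) : emitted (provision B r R k t h) = [] := by
  rw [provision, emitted_append,
    emitted_flatMap_eq_nil _ _ fun _ _ => emitted_copyRange _ _ _ _ _,
    emitted_flatMap_eq_nil _ _ fun _ _ => emitted_copyRange _ _ _ _ _]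
  rfl

theorem sum_map_range' (f : ℕ → ℕ) (k n : ℕ) :
    ((List.range' k (n - k)).map f).sum = ∑ j ∈ Finset.Ico k n, f j := rfl

/-- The slack of two blocks is needed only while one array is copied, so all arrays share it. -/
theorem runs_provision (hB : 1 ≤ B) {cap c : ℕ} (r : ℕ) (R : Finset (Fin a → ℕ)) (k : Fin a)
    (t : Fin a → ℕ) (h : ℕ∞) (hc : c + words k (slice R k t h) + 2 * B ≤ cap) :
    Runs B cap c (provision B r R k t h) (c + words k (slice R k t h)) := by
  rw [words, ← sum_map_range', ← sum_map_range'] at hc ⊢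
  rw [← Nat.add_assoc]
  refine (Runs.flatMap_add _ _ _ (2 * B) (fun j _ c hc => ?_) (by omega)).append
    (Runs.flatMap_add _ _ _ (2 * B) (fun j _ c hc => ?_) (by omega))
  · have := valLength_bounds R k t h j
    exact runs_copyRange hB _ _ _ this.1 this.2 hc
  · exact runs_copyRange hB _ _ _ le_rfl (Nat.le_succ _) hc

theorem readCount_provision_le (hB : 1 ≤ B) (r : ℕ) (R : Finset (Fin a → ℕ)) (k : Fin a)
    (t : Fin a → ℕ) (h : ℕ∞) (hm : words k (slice R k t h) ≤ m * B) :
    readCount (provision B r R k t h) ≤ 2 * a * (m + 3) := by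
  have key : ∀ kind j p len keep, len ≤ m * B + 1 →
      readCount (copyRange B r kind j p len keep) ≤ m + 3 := by
    intro kind j p len keep hlen
    refine (readCount_copyRange kind j p len keep).trans ?_
    have h₁ := length_spanned_mul_le hB p len
    refine Nat.le_of_mul_le_mul_right ?_ hB
    rw [Nat.add_mul]
    omega
  have h₁ : readCount ((List.range' (k : ℕ) (a - k)).flatMap fun j =>
      copyRange B r .val j (startPos R k t j)
        (if j = k then min (width (slice R k t h) j + 1) (children R k t).length
          else width (slice R k t h) j) (width (slice R k t h) j)) ≤ a * (m + 3) := by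
    refine (readCount_flatMap_le _ _ (m + 3) fun j hj => key _ _ _ _ _ ?_).trans ?_
    · rw [List.mem_range'_1] at hj
      have := valLength_bounds R k t h j
      have := width_le_words (k := k) (j := j) hj.1 (by omega) (slice R k t h)
      omega
    · rw [List.length_range']
      exact Nat.mul_le_mul_right _ (by omega)
  have h₂ : readCount ((List.range' (k : ℕ) (a - 1 - k)).flatMap fun j =>
      copyRange B r .idx j (startPos R k t j) (idxLength (slice R k t h) j)
        (idxLength (slice R k t h) j)) ≤ a * (m + 3) := by
    refine (readCount_flatMap_le _ _ (m + 3) fun j hj => key _ _ _ _ _ ?_).trans ?_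
    · rw [List.mem_range'_1] at hj
      have := idxLength_le_words (k := k) (j := j) hj.1 (by omega) (slice R k t h)
      omega
    · rw [List.length_range']
      exact Nat.mul_le_mul_right _ (by omega)
  rw [provision, readCount_append]
  linarith

theorem emitted_locate : emitted (locate B r R k t) = [] :=
  emitted_flatMap_eq_nil _ _ fun _ _ => rfl

theorem readCount_locate_le : readCount (locate B r R k t) ≤ a := by
  refine (readCount_flatMap_le _ _ 1 fun _ _ => le_rfl).trans ?_
  rw [List.length_range']
  omega

theorem runs_locate {cap c : ℕ} (h : c + B ≤ cap) : Runs B cap c (locate B r R k t) c :=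
  Runs.flatMap_const _ _ fun _ _ => runs_peek _ _ _ h

end Trie

/-! ### Leapfrog Triejoin on a box -/

section LFTJ

variable {Q : JoinQuery}

theorem mem_foldl_inter (Cs : List (Finset ℕ)) (C : Finset ℕ) (v : ℕ) :
    v ∈ Cs.foldl (· ∩ ·) C ↔ v ∈ C ∧ ∀ E ∈ Cs, v ∈ E := by
  induction Cs generalizing C with
  | nil => simp
  | cons E Cs ih => simp [ih, and_assoc]

theorem mem_leapfrogJoin {Cs : List (Finset ℕ)} (hne : Cs ≠ []) (v : ℕ) :
    v ∈ leapfrogJoin Cs ↔ ∀ E ∈ Cs, v ∈ E := by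
  cases Cs with
  | nil => exact absurd rfl hne
  | cons C Cs => simp [leapfrogJoin, mem_foldl_inter]

theorem nodup_leapfrogJoin (Cs : List (Finset ℕ)) : (leapfrogJoin Cs).Nodup := by
  cases Cs with
  | nil => exact List.nodup_nil
  | cons C Cs => exact Finset.sort_nodup _ _

theorem columns_ne_nil (st : BoxState Q) (d : Fin Q.numVars) (θ : Fin Q.numVars → ℕ) :
    columns st d θ ≠ [] := by
  obtain ⟨j, p, hp⟩ := Q.var_cover d
  refine List.ne_nil_of_mem (a := ((st.slices j).filter fun x => ∀ q, q < p →
    x q = θ (Q.var j q)).image fun x => x p) ?_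
  simp only [columns, List.mem_flatMap, List.mem_map, List.mem_filter]
  exact ⟨j, List.mem_finRange j, p, ⟨List.mem_finRange p, by simpa using hp⟩, rfl⟩

theorem mem_leapfrogJoin_columns (st : BoxState Q) (d : Fin Q.numVars) (θ : Fin Q.numVars → ℕ)
    (v : ℕ) : v ∈ leapfrogJoin (columns st d θ) ↔ ∀ j p, Q.var j p = d →
      ∃ x ∈ st.slices j, (∀ q, q < p → x q = θ (Q.var j q)) ∧ x p = v := by
  rw [mem_leapfrogJoin (columns_ne_nil st d θ)]
  simp only [columns, List.mem_flatMap, List.mem_map, List.mem_filter, List.mem_finRange,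
    true_and, decide_eq_true_eq]
  constructor
  · intro h j p hp
    simpa [and_assoc] using h _ ⟨j, p, hp, rfl⟩
  · rintro h _ ⟨j, p, hp, rfl⟩
    simpa [and_assoc] using h j p hp

/-- Atoms follow the key order, so the attributes before one that carries `d` belong to variables
smaller than `d`. These are already final when `d` is bound, and the column can be described by `τ`
instead of the partial assignment. -/
theorem mem_lftj (st : BoxState Q) (ds : List (Fin Q.numVars)) (hds : ds.Pairwise (· < ·))
    (θ τ : Fin Q.numVars → ℕ) :
    τ ∈ lftj st ds θ ↔ (∀ d, d ∉ ds → τ d = θ d) ∧ ∀ d ∈ ds, st.low d ≤ τ d ∧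
      (τ d : ℕ∞) ≤ st.high d ∧ ∀ j p, Q.var j p = d →
        ∃ x ∈ st.slices j, (∀ q, q < p → x q = τ (Q.var j q)) ∧ x p = τ d := by
  induction ds generalizing θ with
  | nil => simp [lftj, funext_iff]
  | cons d ds ih =>
    obtain ⟨hd, hds⟩ := List.pairwise_cons.1 hds
    have hnot : d ∉ ds := fun h => lt_irrefl _ (hd d h)
    simp only [lftj, List.mem_flatMap, List.mem_filter, ih hds, decide_eq_true_eq,
      mem_leapfrogJoin_columns]
    constructor
    · rintro ⟨v, ⟨hv, hlo, hhi⟩, heq, hrest⟩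
      have hτd : τ d = v := by simpa using heq d hnot
      have hpre : ∀ e, e < d → τ e = θ e := by
        intro e he
        have := heq e fun h => lt_asymm he (hd e h)
        rwa [Function.update_of_ne he.ne] at this
      refine ⟨fun e he => ?_, fun e he => ?_⟩
      · rw [List.mem_cons, not_or] at he
        have := heq e he.2
        rwa [Function.update_of_ne he.1] at this
      · rcases List.mem_cons.1 he with rfl | he
        · refine ⟨hτd ▸ hlo, hτd ▸ hhi, fun j p hp => ?_⟩
          obtain ⟨x, hx, hq, hxp⟩ := hv j p hp
          refine ⟨x, hx, fun q hqp => ?_, hxp.trans hτd.symm⟩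
          rw [hq q hqp, hpre]
          exact hp ▸ Q.var_strictMono j hqp
        · exact hrest e he
    · rintro ⟨heq, hall⟩
      obtain ⟨hlo, hhi, hcol⟩ := hall d (by simp)
      refine ⟨τ d, ⟨fun j p hp => ?_, hlo, hhi⟩, fun e he => ?_, fun e he => hall e (by simp [he])⟩
      · obtain ⟨x, hx, hq, hxp⟩ := hcol j p hp
        refine ⟨x, hx, fun q hqp => ?_, hxp⟩
        have hlt : Q.var j q < d := hp ▸ Q.var_strictMono j hqp
        rw [hq q hqp, heq]
        rw [List.mem_cons, not_or]
        exact ⟨hlt.ne, fun h => lt_asymm hlt (hd _ h)⟩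
      · by_cases h : e = d
        · subst h; simp
        · rw [Function.update_of_ne h]
          exact heq e (by simp [h, he])

theorem nodup_lftj (st : BoxState Q) (ds : List (Fin Q.numVars)) (hds : ds.Pairwise (· < ·))
    (θ : Fin Q.numVars → ℕ) : (lftj st ds θ).Nodup := by
  induction ds generalizing θ with
  | nil => exact List.nodup_singleton θ
  | cons d ds ih =>
    obtain ⟨hd, hds⟩ := List.pairwise_cons.1 hds
    have hnot : d ∉ ds := fun h => lt_irrefl _ (hd d h)
    rw [lftj, List.nodup_flatMap]
    refine ⟨fun v _ => ih hds _, ?_⟩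
    refine ((nodup_leapfrogJoin _).filter _).imp ?_
    intro v w hvw τ hv hw
    rw [mem_lftj st ds hds] at hv hw
    have h₁ := hv.1 d hnot
    have h₂ := hw.1 d hnot
    rw [Function.update_self] at h₁ h₂
    exact hvw (h₁.symm.trans h₂)

/-- Leapfrog Triejoin lists the answers in the box, if the slices contain what is relevant for the
box. -/
theorem mem_lftj_finRange {D : Database Q} {st : BoxState Q}
    (h₁ : ∀ j, st.slices j ⊆ D (Q.rel j))
    (h₂ : ∀ j, ∀ x ∈ D (Q.rel j), (∀ p, st.low (Q.var j p) ≤ x p ∧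
      (x p : ℕ∞) ≤ st.high (Q.var j p)) → x ∈ st.slices j) (θ τ : Fin Q.numVars → ℕ) :
    τ ∈ lftj st (List.finRange Q.numVars) θ ↔
      τ ∈ answers Q D ∧ ∀ d, st.low d ≤ τ d ∧ (τ d : ℕ∞) ≤ st.high d := by
  rw [mem_lftj st _ (List.pairwise_lt_finRange _)]
  simp only [List.mem_finRange, not_true_eq_false, false_imp_iff, implies_true, true_and,
    true_imp_iff]
  constructor
  · intro h
    refine ⟨fun j => ?_, fun d => ⟨(h d).1, (h d).2.1⟩⟩
    have hpos := Q.arity_pos (Q.rel j)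
    -- At the last attribute of an atom the column condition supplies one tuple that agrees with `τ`
    -- on all attributes.
    obtain ⟨x, hx, hq, hxp⟩ := (h (Q.var j ⟨Q.arity (Q.rel j) - 1, by omega⟩)).2.2 j _ rfl
    convert h₁ j hx using 1
    funext p
    rcases Nat.lt_or_ge p (Q.arity (Q.rel j) - 1) with hp | hp
    · exact (hq p hp).symm
    · have : p = ⟨Q.arity (Q.rel j) - 1, by omega⟩ := Fin.ext (by simp; omega)
      rw [this, hxp]
  · rintro ⟨hans, hbox⟩ d
    refine ⟨(hbox d).1, (hbox d).2, ?_⟩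
    rintro j p rfl
    exact ⟨_, h₂ j _ (hans j) fun p => hbox _, fun _ _ => rfl, rfl⟩

theorem emitted_runLFTJ (st : BoxState Q) :
    emitted (runLFTJ st) =
      (lftj st (List.finRange Q.numVars) fun _ => 0).flatMap List.ofFn := by
  rw [runLFTJ, emitted_flatMap]
  simp only [emitted_map_emit]

theorem readCount_runLFTJ (st : BoxState Q) : readCount (runLFTJ st) = 0 :=
  Nat.le_zero.1 ((readCount_flatMap_le _ _ 0 fun _ _ => (readCount_map_emit _).le).trans_eq
    (Nat.mul_zero _))

theorem runs_runLFTJ {B cap : ℕ} (st : BoxState Q) (c : ℕ) : Runs B cap c (runLFTJ st) c :=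
  Runs.flatMap_const _ _ fun _ _ => Runs.map_emit _ c

end LFTJ

/-! ### One round -/

section Round

variable {Q : JoinQuery} {D : Database Q} {B : ℕ} {st : BoxState Q} {i : Fin Q.numVars}
  {mem : ℕ} {j : Fin Q.numAtoms}

theorem active_eq_some_iff {k : Fin (Q.arity (Q.rel j))} :
    active st i j = some k ↔ st.pending j = some k ∧ Q.var j k = i := by
  simp [active, Option.filter_eq_some_iff]

theorem probeAtom_of_active {k : Fin (Q.arity (Q.rel j))} (h : active st i j = some k) :
    probeAtom D B st i mem j =
      some (probe B (Q.rel j) (share st i mem) (D (Q.rel j)) k (startTuple st j)) := by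
  rw [probeAtom, h, Option.map_some]

theorem probeAtom_of_not_active (h : active st i j = none) :
    probeAtom D B st i mem j = none := by
  rw [probeAtom, h, Option.map_none]

theorem spilled_iff_of_active {k : Fin (Q.arity (Q.rel j))} (h : active st i j = some k) :
    spilled D B st i mem j = true ↔
      (probe B (Q.rel j) (share st i mem) (D (Q.rel j)) k (startTuple st j)).1 = none := by
  rw [spilled, probeAtom_of_active h]
  rcases probe B (Q.rel j) (share st i mem) (D (Q.rel j)) k (startTuple st j) with ⟨_ | _, _⟩ <;>
    simp

theorem exists_active_of_spilled (h : spilled D B st i mem j = true) :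
    ∃ k, active st i j = some k := by
  cases ha : active st i j with
  | none => rw [spilled, probeAtom_of_not_active ha] at h; exact absurd h (by simp)
  | some k => exact ⟨k, rfl⟩

theorem loaded_eq_some_iff {k : Fin (Q.arity (Q.rel j))} :
    loaded D B st i mem j = some k ↔ spilled D B st i mem j = false ∧ active st i j = some k := by
  cases h : spilled D B st i mem j <;> simp [loaded, h]

theorem startTuple_of_active {k : Fin (Q.arity (Q.rel j))} (h : active st i j = some k) :
    startTuple st j k = st.low i := by
  rw [startTuple, (active_eq_some_iff.1 h).2]

theorem foldr_min_le {l : List ℕ∞} {h : ℕ∞} (hl : h ∈ l) : l.foldr min ⊤ ≤ h := by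
  induction l with
  | nil => simp at hl
  | cons a l ih =>
    rcases List.mem_cons.1 hl with rfl | hl
    · exact min_le_left _ _
    · exact (min_le_right _ _).trans (ih hl)

theorem foldr_min_eq_top_or_mem (l : List ℕ∞) : l.foldr min ⊤ = ⊤ ∨ l.foldr min ⊤ ∈ l := by
  induction l with
  | nil => simp
  | cons a l ih =>
    rw [List.foldr_cons]
    rcases min_choice a (l.foldr min ⊤) with h | h <;> rw [h]
    · simp
    · exact ih.imp id (List.mem_cons_of_mem _)

theorem upperBound_of_spilled (h : spilled D B st i mem j = true) :
    upperBound D B st i mem = st.low i := by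
  rw [upperBound, if_pos]
  exact List.any_eq_true.2 ⟨j, List.mem_finRange j, h⟩

theorem mem_probed_iff {h : ℕ∞} :
    h ∈ ((List.finRange Q.numAtoms).filterMap fun j =>
      (probeAtom D B st i mem j).bind Prod.fst) ↔ ∃ j k, active st i j = some k ∧
        (probe B (Q.rel j) (share st i mem) (D (Q.rel j)) k (startTuple st j)).1 = some h := by
  rw [List.mem_filterMap]
  constructor
  · rintro ⟨j, -, hj⟩
    cases ha : active st i j with
    | none => rw [probeAtom_of_not_active ha] at hj; simp at hj
    | some k =>
      rw [probeAtom_of_active ha] at hj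
      exact ⟨j, k, ha, hj⟩
  · rintro ⟨j, k, ha, hj⟩
    refine ⟨j, List.mem_finRange j, ?_⟩
    rw [probeAtom_of_active ha]
    exact hj

theorem low_le_upperBound (hB : 1 ≤ B) : (st.low i : ℕ∞) ≤ upperBound D B st i mem := by
  rw [upperBound]
  split_ifs with h
  · exact le_rfl
  · rcases foldr_min_eq_top_or_mem ((List.finRange Q.numAtoms).filterMap fun j =>
      (probeAtom D B st i mem j).bind Prod.fst) with h | h
    · rw [h]; exact le_top
    · obtain ⟨j, k, ha, hj⟩ := mem_probed_iff.1 h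
      rw [← startTuple_of_active ha]
      rcases probe_cases hB (Q.rel j) (share st i mem) (D (Q.rel j)) k (startTuple st j) with
        h' | ⟨h₀, h', hle, -⟩ | h'
      · rw [Option.some.inj (hj.symm.trans h'.1)]; exact le_top
      · rw [Option.some.inj (hj.symm.trans h')]; exact_mod_cast hle
      · exact absurd (hj.symm.trans h'.1) (by simp)

/-- The common upper bound is at most the atom's own probed bound: it is the minimum of the probed
bounds or, after a spill elsewhere, the lower bound of the interval, below which no probe ends. -/
theorem words_newSlice_le (hB : 1 ≤ B) {k : Fin (Q.arity (Q.rel j))}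
    (h : loaded D B st i mem j = some k) :
    words k (newSlice D B st i mem j k) ≤ share st i mem * B := by
  obtain ⟨hs, ha⟩ := loaded_eq_some_iff.1 h
  have hs' := mt (spilled_iff_of_active (D := D) (B := B) (mem := mem) ha).2 (by simp [hs])
  have key : ∃ b, (probe B (Q.rel j) (share st i mem) (D (Q.rel j)) k (startTuple st j)).1 = some b ∧
      (st.low i : ℕ∞) ≤ b ∧
      words k (slice (D (Q.rel j)) k (startTuple st j) b) ≤ share st i mem * B := by
    rcases probe_cases hB (Q.rel j) (share st i mem) (D (Q.rel j)) k (startTuple st j) with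
      h' | ⟨h₀, h', hle, hw, -⟩ | h'
    · exact ⟨⊤, h'.1, le_top, h'.2⟩
    · rw [startTuple_of_active ha] at hle
      exact ⟨h₀, h', by exact_mod_cast hle, hw⟩
    · exact absurd h'.1 hs'
  obtain ⟨b, hb, hlow, hw⟩ := key
  refine (words_mono k (slice_mono _ _ _ ?_)).trans hw
  rw [upperBound]
  split_ifs
  · exact hlow
  · exact foldr_min_le (mem_probed_iff.2 ⟨j, k, ha, hb⟩)

/-- A single value at the last level takes at most one word, and every share is at least one block;
hence a spilled atom always has a next variable. -/
theorem succ_lt_arity_of_spilled (hB : 1 ≤ B) {k : Fin (Q.arity (Q.rel j))}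
    (ha : active st i j = some k) (h : spilled D B st i mem j = true) :
    (k : ℕ) + 1 < Q.arity (Q.rel j) := by
  rw [spilled_iff_of_active ha] at h
  by_contra hk
  have h₁ := words_slice_self_le (D (Q.rel j)) k (startTuple st j) (not_lt.1 hk)
  have h₂ : 1 * 1 ≤ share st i mem * B := Nat.mul_le_mul (le_max_left _ _) hB
  rcases probe_cases hB (Q.rel j) (share st i mem) (D (Q.rel j)) k (startTuple st j) with
    h' | ⟨h₀, h', -⟩ | h'
  · exact absurd (h.symm.trans h'.1) (by simp)
  · exact absurd (h.symm.trans h') (by simp)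
  · omega

/-- A round that does not reach the end of the domain is limited by an atom that exceeds its share
together with the next value. -/
theorem exists_exceeding_of_upperBound (hB : 1 ≤ B) {h : ℕ}
    (hu : upperBound D B st i mem = h) :
    ∃ j k, active st i j = some k ∧ share st i mem * B <
      words k (slice (D (Q.rel j)) k (startTuple st j) ((h + 1 : ℕ) : ℕ∞)) := by
  by_cases hsp : ∃ j, spilled D B st i mem j = true
  · obtain ⟨j, hj⟩ := hsp
    obtain ⟨k, ha⟩ := exists_active_of_spilled hj
    have hh : st.low i = h := by
      have := (upperBound_of_spilled hj).symm.trans hu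
      exact_mod_cast this
    refine ⟨j, k, ha, ?_⟩
    rw [spilled_iff_of_active ha] at hj
    rcases probe_cases hB (Q.rel j) (share st i mem) (D (Q.rel j)) k (startTuple st j) with
      h' | ⟨h₀, h', -⟩ | h'
    · exact absurd (hj.symm.trans h'.1) (by simp)
    · exact absurd (hj.symm.trans h') (by simp)
    · refine h'.2.trans_le (words_mono k (slice_mono _ _ _ ?_))
      rw [startTuple_of_active ha, hh]
      exact_mod_cast Nat.le_succ h
  · rw [upperBound, if_neg (by simpa using hsp)] at hu
    rcases foldr_min_eq_top_or_mem ((List.finRange Q.numAtoms).filterMap fun j =>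
      (probeAtom D B st i mem j).bind Prod.fst) with h' | h'
    · exact absurd (h'.symm.trans hu) (by simp)
    · rw [hu] at h'
      obtain ⟨j, k, ha, hj⟩ := mem_probed_iff.1 h'
      refine ⟨j, k, ha, ?_⟩
      rcases probe_cases hB (Q.rel j) (share st i mem) (D (Q.rel j)) k (startTuple st j) with
        h' | ⟨h₀, h', -, -, hlt⟩ | h'
      · exact absurd (hj.symm.trans h'.1) (by simp)
      · have : (h : ℕ∞) = h₀ := Option.some.inj (hj.symm.trans h')
        rwa [show h = h₀ by exact_mod_cast this]
      · exact absurd (hj.symm.trans h'.1) (by simp)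

/-! ### Memory use of a round -/

variable (D B st i mem) in
/-- The number of words that atom `j` occupies after the round, if it is provisioned in it. -/
noncomputable def loadedWords (j : Fin Q.numAtoms) : ℕ :=
  match loaded D B st i mem j with
  | none => 0
  | some k => words k (newSlice D B st i mem j k)

/-- The number of atoms that still have to be provisioned. -/
def numPending (st : BoxState Q) : ℕ := ∑ j, if (st.pending j).isSome then 1 else 0

variable (D B st i mem) in
/-- The number of atoms that are provisioned in the round. -/
def numLoaded : ℕ := ∑ j, if (loaded D B st i mem j).isSome then 1 else 0

theorem arity_le_maxArity (Q : JoinQuery) (r : Fin Q.numRels) : Q.arity r ≤ Q.maxArity :=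
  Finset.le_sup (f := Q.arity) (Finset.mem_univ r)

theorem numActive_eq_sum : numActive st i = ∑ j, if (active st i j).isSome then 1 else 0 := by
  rw [numActive, Fin.sum_univ_def]
  induction List.finRange Q.numAtoms with
  | nil => rfl
  | cons j l ih => rw [List.countP_cons, ih, List.map_cons, List.sum_cons, Nat.add_comm]

theorem numActive_le : numActive st i ≤ Q.numAtoms :=
  List.countP_le_length.trans_eq (List.length_finRange)

theorem sum_loadedWords_le (hB : 1 ≤ B) :
    ((List.finRange Q.numAtoms).map (loadedWords D B st i mem)).sum ≤
      usedMem D B st i mem * B := by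
  rw [usedMem, ← Fin.sum_univ_def, ← Fin.sum_univ_def, Finset.sum_mul]
  refine Finset.sum_le_sum fun j _ => ?_
  rw [loadedWords]
  cases loaded D B st i mem j with
  | none => exact Nat.zero_le _
  | some k => exact le_blocksFor_mul hB _

/-- If the even division leaves at least one block per atom, the shares sum to at most `mem`.
Otherwise each share is the enforced single block. -/
theorem usedMem_le (hB : 1 ≤ B) :
    usedMem D B st i mem ≤ mem ∨ usedMem D B st i mem ≤ numLoaded D B st i mem := by
  have h₁ : usedMem D B st i mem ≤ numLoaded D B st i mem * share st i mem := by
    rw [usedMem, ← Fin.sum_univ_def, numLoaded, Finset.sum_mul]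
    refine Finset.sum_le_sum fun j _ => ?_
    cases h : loaded D B st i mem j with
    | none => exact Nat.zero_le _
    | some k =>
      simp only [Option.isSome_some, if_true, Nat.one_mul]
      exact (blocksFor_le_iff hB).2 (words_newSlice_le hB h)
  have h₂ : numLoaded D B st i mem ≤ numActive st i := by
    rw [numActive_eq_sum]
    refine Finset.sum_le_sum fun j _ => ?_
    cases h : loaded D B st i mem j with
    | none => exact Nat.zero_le _
    | some k => rw [(loaded_eq_some_iff.1 h).2]
  rcases Nat.lt_or_ge (mem / numActive st i) 1 with h | h
  · rw [share, max_eq_left h.le, Nat.mul_one] at h₁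
    exact .inr h₁
  · rw [share, max_eq_right h] at h₁
    exact .inl (h₁.trans ((Nat.mul_le_mul_right _ h₂).trans (Nat.mul_div_le _ _)))

/-- A loaded atom stops being pending, so the blocks lost to rounding up can be charged to pending
atoms. -/
theorem numPending_advance_add_le :
    numPending (advance D B st i mem) + numLoaded D B st i mem ≤ numPending st := by
  rw [numPending, numLoaded, numPending, ← Finset.sum_add_distrib]
  refine Finset.sum_le_sum fun j _ => ?_
  cases ha : active st i j with
  | none =>
    have : loaded D B st i mem j = none := by rw [loaded, ha, ite_self]
    simp [advance, ha, this]
  | some k =>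
    have hp := (active_eq_some_iff.1 ha).1
    cases hs : spilled D B st i mem j with
    | true =>
      have : loaded D B st i mem j = none := by rw [loaded, if_pos hs]
      simp only [this, hp, Option.isSome_none, Option.isSome_some, Bool.false_eq_true, if_true,
        if_false]
      split_ifs <;> simp
    | false =>
      simp [advance, ha, hs, hp, loaded]

theorem runs_roundSteps (hB : 1 ≤ B) {cap c : ℕ}
    (hc : c + ((List.finRange Q.numAtoms).map (loadedWords D B st i mem)).sum +
      2 * Q.maxArity * B ≤ cap) :
    Runs B cap c (roundSteps D B st i mem)
      (c + ((List.finRange Q.numAtoms).map (loadedWords D B st i mem)).sum) := by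
  have har : ∀ j, 2 * Q.arity (Q.rel j) * B ≤ 2 * Q.maxArity * B := fun j =>
    Nat.mul_le_mul_right _ (Nat.mul_le_mul_left _ (arity_le_maxArity Q _))
  have har' : ∀ j, 2 * B ≤ 2 * Q.arity (Q.rel j) * B := fun j =>
    Nat.mul_le_mul_right _ (Nat.le_mul_of_pos_right 2 (Q.arity_pos (Q.rel j)))
  refine Runs.append (c₁ := c) (Runs.flatMap_const _ _ fun j _ => ?_)
    (Runs.flatMap_add _ _ _ (2 * Q.maxArity * B) (fun j _ c hc => ?_) hc)
  · cases ha : active st i j with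
    | none => rw [probeAtom_of_not_active ha]; exact .nil c
    | some k =>
      rw [probeAtom_of_active ha]
      have := har j
      exact runs_probe (by omega)
  · have h₁ := har j
    have h₂ := har' j
    cases ha : active st i j with
    | none =>
      have : loaded D B st i mem j = none := by rw [loaded, ha, ite_self]
      simp only [loadedWords, this]
      exact .nil c
    | some k =>
      cases hs : spilled D B st i mem j with
      | true =>
        have : loaded D B st i mem j = none := by rw [loaded, if_pos hs]
        simp only [loadedWords, this, if_true]
        exact runs_locate (by omega)
      | false =>
        have : loaded D B st i mem j = some k := loaded_eq_some_iff.2 ⟨hs, ha⟩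
        simp only [loadedWords, this] at hc ⊢
        simp only [Bool.false_eq_true, if_false]
        exact runs_provision hB _ _ _ _ _ (by rw [newSlice] at hc; omega)

theorem runs_releaseSteps {cap : ℕ} (c : ℕ) :
    Runs B cap (c + ((List.finRange Q.numAtoms).map (loadedWords D B st i mem)).sum)
      (releaseSteps D B st i mem) c := by
  refine Runs.flatMap_sub _ _ _ (fun j _ c => ?_) c
  rw [loadedWords]
  cases loaded D B st i mem j with
  | none => exact .nil c
  | some k =>
    refine .discard (Nat.le_add_left _ _) ?_
    rw [Nat.add_sub_cancel]
    exact .nil c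

theorem emitted_roundSteps : emitted (roundSteps D B st i mem) = [] := by
  rw [roundSteps, emitted_append, emitted_flatMap_eq_nil, emitted_flatMap_eq_nil]
  · rfl
  · intro j _
    cases active st i j with
    | none => rfl
    | some k =>
      dsimp only
      split_ifs
      · exact emitted_locate
      · exact emitted_provision _
  · intro j _
    cases ha : active st i j with
    | none => rw [probeAtom_of_not_active ha]; rfl
    | some k => rw [probeAtom_of_active ha]; exact emitted_probe

theorem emitted_releaseSteps : emitted (releaseSteps D B st i mem) = [] := by
  refine emitted_flatMap_eq_nil _ _ fun j _ => ?_
  cases loaded D B st i mem j <;> rfl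

theorem readCount_releaseSteps : readCount (releaseSteps D B st i mem) = 0 := by
  refine Nat.le_zero.1 ((readCount_flatMap_le _ _ 0 fun j _ => ?_).trans_eq (Nat.mul_zero _))
  cases loaded D B st i mem j <;> exact le_rfl

theorem readCount_roundSteps_le (hB : 1 ≤ B) :
    readCount (roundSteps D B st i mem) ≤
      12 * (Q.numAtoms * Q.maxArity) * share st i mem := by
  -- A share of at least one block absorbs the additive constants: probing costs at most `4a` shares
  -- per atom, and loading or locating at most `8a`.
  have hsh : 1 ≤ share st i mem := le_max_left _ _
  have h₁ : readCount ((List.finRange Q.numAtoms).flatMap fun j =>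
      match probeAtom D B st i mem j with
      | none => []
      | some (_, tr) => tr) ≤ Q.numAtoms * (4 * Q.maxArity * share st i mem) := by
    refine (readCount_flatMap_le _ _ _ fun j _ => ?_).trans_eq (by rw [List.length_finRange])
    cases ha : active st i j with
    | none => rw [probeAtom_of_not_active ha]; exact Nat.zero_le _
    | some k =>
      rw [probeAtom_of_active ha]
      refine (readCount_probe_le hB _ _ _ _ _).trans ?_
      have h := arity_le_maxArity Q (Q.rel j)
      have hp := Q.arity_pos (Q.rel j)
      nlinarith [Nat.mul_le_mul h hsh, Nat.mul_le_mul_right (share st i mem) h]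
  have h₂ : readCount ((List.finRange Q.numAtoms).flatMap fun j =>
      match active st i j with
      | none => []
      | some k =>
        if spilled D B st i mem j then locate B (Q.rel j) (D (Q.rel j)) k (startTuple st j)
        else provision B (Q.rel j) (D (Q.rel j)) k (startTuple st j) (upperBound D B st i mem)) ≤
      Q.numAtoms * (8 * Q.maxArity * share st i mem) := by
    refine (readCount_flatMap_le _ _ _ fun j _ => ?_).trans_eq (by rw [List.length_finRange])
    have h := arity_le_maxArity Q (Q.rel j)
    cases ha : active st i j with
    | none => exact Nat.zero_le _
    | some k =>
      dsimp only
      split_ifs with hs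
      · refine readCount_locate_le.trans ?_
        nlinarith [Nat.mul_le_mul h hsh]
      · have hl : loaded D B st i mem j = some k :=
          loaded_eq_some_iff.2 ⟨by simpa using hs, ha⟩
        refine (readCount_provision_le hB _ _ _ _ _ (words_newSlice_le hB hl)).trans ?_
        nlinarith [Nat.mul_le_mul h hsh, Nat.mul_le_mul_right (share st i mem) h]
  rw [roundSteps, readCount_append]
  exact (Nat.add_le_add h₁ h₂).trans_eq (by ring)

end Round

/-! ### The memory of the boxing procedure -/

section Boxing

variable {Q : JoinQuery} {D : Database Q} {B : ℕ}

theorem runs_repeatRounds {cap c : ℕ} {i : Fin Q.numVars} {body : BoxState Q → List Step × ℕ∞}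
    (P : BoxState Q → Prop) (hP : ∀ st v, P st → P { st with low := Function.update st.low i v })
    (h : ∀ st, P st → Runs B cap c (body st).1 c) (fuel : ℕ) {st : BoxState Q} (hst : P st) :
    Runs B cap c (repeatRounds i body fuel st) c := by
  induction fuel generalizing st with
  | zero => exact .nil c
  | succ fuel ih =>
    rw [repeatRounds]
    refine (h st hst).append ?_
    split_ifs
    · exact .nil c
    · exact ih (hP st _ hst)

/-- Besides the leftover and the budgets of the remaining dimensions, one block is reserved per
pending atom; the `2 * Q.maxArity` work blocks are reused in every round. -/
theorem runs_boxUp (hB : 1 ≤ B) (budget : ℕ) {cap : ℕ} (is : List (Fin Q.numVars))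
    {leftover c : ℕ} {st : BoxState Q}
    (hc : c + (leftover + budget * is.length + numPending st) * B + 2 * Q.maxArity * B ≤ cap) :
    Runs B cap c (boxUp D B budget is leftover st) c := by
  induction is generalizing leftover c st with
  | nil => exact runs_runLFTJ st c
  | cons i is ih =>
    rw [boxUp]
    refine runs_repeatRounds (fun st' => st'.pending = st.pending) (fun _ _ h => h)
      (fun st' hst' => ?_) _ rfl
    have hnp : numPending st' = numPending st := by rw [numPending, hst', numPending]
    have hw := sum_loadedWords_le (D := D) (st := st') (i := i) (mem := budget + leftover) hB
    have hp := numPending_advance_add_le (D := D) (B := B) (st := st') (i := i)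
      (mem := budget + leftover)
    -- If the round stays within its memory, the subtraction is exact. If not, the truncated
    -- difference is `0` and the excess comes out of the reserve for pending atoms.
    have key : usedMem D B st' i (budget + leftover) +
        (budget + leftover - usedMem D B st' i (budget + leftover) + budget * is.length +
          numPending (advance D B st' i (budget + leftover))) ≤
        leftover + budget * (is.length + 1) + numPending st := by
      rw [Nat.mul_succ]
      rcases usedMem_le (D := D) (st := st') (i := i) (mem := budget + leftover) hB with h | h
      · omega
      · omega
    have key' := Nat.mul_le_mul_right B key
    rw [Nat.add_mul] at key'
    rw [List.length_cons] at hc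
    exact ((runs_roundSteps hB (by omega)).append (ih (by omega))).append (runs_releaseSteps c)

/-! ### The output of the boxing procedure -/

/-- The invariant of the boxing procedure when `d` dimensions are fixed. -/
structure Invariant (D : Database Q) (d : ℕ) (st : BoxState Q) : Prop where
  le_var : ∀ j k, st.pending j = some k → d ≤ Q.var j k
  spilled_prefix : ∀ j k, st.pending j = some k → ∀ p, p < k →
    (Q.var j p : ℕ) < d ∧ st.high (Q.var j p) = st.low (Q.var j p)
  subset : ∀ j, st.pending j = none → st.slices j ⊆ D (Q.rel j)
  mem_slices : ∀ j, st.pending j = none → ∀ x ∈ D (Q.rel j),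
    (∀ p, (Q.var j p : ℕ) < d → st.low (Q.var j p) ≤ x p ∧ (x p : ℕ∞) ≤ st.high (Q.var j p)) →
    x ∈ st.slices j

theorem invariant_initialState (D : Database Q) : Invariant D 0 (initialState Q) where
  le_var _ _ _ := Nat.zero_le _
  spilled_prefix j k hk p hp := by
    obtain rfl : _ = k := Option.some.inj hk
    exact absurd hp (Nat.not_lt_zero _)
  subset _ h := absurd h (by simp [initialState])
  mem_slices _ h := absurd h (by simp [initialState])

theorem Invariant.update_low {d : ℕ} {st : BoxState Q} (h : Invariant D d st)
    {i : Fin Q.numVars} (hi : (i : ℕ) = d) (v : ℕ) :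
    Invariant D d { st with low := Function.update st.low i v } := by
  have key : ∀ e : Fin Q.numVars, (e : ℕ) < d → Function.update st.low i v e = st.low e :=
    fun e he => Function.update_of_ne (fun h => by rw [h] at he; omega) _ _
  refine ⟨h.le_var, fun j k hk p hp => ?_, h.subset, fun j hj x hx hbox => ?_⟩
  · have := h.spilled_prefix j k hk p hp
    exact ⟨this.1, by simpa only [key _ this.1] using this.2⟩
  · refine h.mem_slices j hj x hx fun p hp => ?_
    simpa only [key _ hp] using hbox p hp

theorem Invariant.advance (hB : 1 ≤ B) {d mem : ℕ} {st : BoxState Q} (h : Invariant D d st)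
    {i : Fin Q.numVars} (hi : (i : ℕ) = d) :
    Invariant D (d + 1) (advance D B st i mem) := by
  have hhigh : ∀ e : Fin Q.numVars, (e : ℕ) < d →
      (BoxedJoin.advance D B st i mem).high e = st.high e :=
    fun e he => Function.update_of_ne (fun h => by rw [h] at he; omega) _ _
  have hhigh' : (BoxedJoin.advance D B st i mem).high i = upperBound D B st i mem :=
    Function.update_self _ _ _
  -- the three ways an atom can leave the round
  have hcases : ∀ j,
      (active st i j = none ∧ (BoxedJoin.advance D B st i mem).pending j = st.pending j ∧
        (BoxedJoin.advance D B st i mem).slices j = st.slices j) ∨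
      (∃ k : Fin (Q.arity (Q.rel j)), ∃ hk : (k : ℕ) + 1 < Q.arity (Q.rel j), active st i j = some k ∧
        spilled D B st i mem j = true ∧
        (BoxedJoin.advance D B st i mem).pending j = some ⟨k + 1, hk⟩) ∨
      (∃ k, active st i j = some k ∧ (BoxedJoin.advance D B st i mem).pending j = none ∧
        (BoxedJoin.advance D B st i mem).slices j = newSlice D B st i mem j k) := by
    intro j
    cases ha : active st i j with
    | none =>
      have hl : loaded D B st i mem j = none := by rw [loaded, ha, ite_self]
      exact .inl ⟨rfl, by simp [BoxedJoin.advance, ha], by simp [BoxedJoin.advance, hl]⟩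
    | some k =>
      cases hs : spilled D B st i mem j with
      | true =>
        have hk := succ_lt_arity_of_spilled hB ha hs
        exact .inr (.inl ⟨k, hk, rfl, rfl, by simp [BoxedJoin.advance, ha, hs, hk]⟩)
      | false =>
        have hl : loaded D B st i mem j = some k := loaded_eq_some_iff.2 ⟨hs, ha⟩
        exact .inr (.inr ⟨k, rfl, by simp [BoxedJoin.advance, ha, hs],
          by simp [BoxedJoin.advance, hl]⟩)
  refine ⟨fun j k hk => ?_, fun j k hk p hp => ?_, fun j hj => ?_, fun j hj x hx hbox => ?_⟩
  · rcases hcases j with ⟨ha, hp, -⟩ | ⟨k', hk', ha, -, hp⟩ | ⟨k', -, hp, -⟩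
    · rw [hp] at hk
      have h₁ := h.le_var j k hk
      have h₂ : Q.var j k ≠ i := fun he => by
        rw [active_eq_some_iff.2 ⟨hk, he⟩] at ha
        exact absurd ha (by simp)
      have h₃ : (Q.var j k : ℕ) ≠ i := fun he => h₂ (Fin.ext he)
      omega
    · obtain rfl : _ = k := Option.some.inj (hp.symm.trans hk)
      have h₁ : Q.var j k' < Q.var j ⟨k' + 1, hk'⟩ :=
        Q.var_strictMono j (Fin.lt_def.2 (Nat.lt_succ_self _))
      rw [(active_eq_some_iff.1 ha).2, Fin.lt_def] at h₁
      omega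
    · exact absurd (hp.symm.trans hk) (by simp)
  · rcases hcases j with ⟨ha, hp', -⟩ | ⟨k', hk', ha, hs, hp'⟩ | ⟨k', -, hp', -⟩
    · have := h.spilled_prefix j k (hp' ▸ hk) p hp
      exact ⟨by omega, by rw [hhigh _ this.1]; exact this.2⟩
    · obtain rfl : _ = k := Option.some.inj (hp'.symm.trans hk)
      have hpk : (p : ℕ) < k' + 1 := hp
      rcases Nat.lt_succ_iff_lt_or_eq.1 hpk with hlt | heq
      · have := h.spilled_prefix j k' (active_eq_some_iff.1 ha).1 p hlt
        exact ⟨by omega, by rw [hhigh _ this.1]; exact this.2⟩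
      · obtain rfl : p = k' := Fin.ext heq
        rw [(active_eq_some_iff.1 ha).2, hhigh', upperBound_of_spilled hs]
        exact ⟨by omega, rfl⟩
    · exact absurd (hp'.symm.trans hk) (by simp)
  · rcases hcases j with ⟨ha, hp', hsl⟩ | ⟨k', hk', -, -, hp'⟩ | ⟨k', -, hp', hsl⟩
    · rw [hsl]
      exact h.subset j (hp' ▸ hj)
    · exact absurd (hp'.symm.trans hj) (by simp)
    · rw [hsl]
      exact Finset.filter_subset _ _
  · rcases hcases j with ⟨ha, hp', hsl⟩ | ⟨k', hk', -, -, hp'⟩ | ⟨k', ha, hp', hsl⟩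
    · rw [hsl]
      refine h.mem_slices j (hp' ▸ hj) x hx fun p hp => ?_
      have := hbox p (by omega)
      rwa [hhigh _ hp] at this
    · exact absurd (hp'.symm.trans hj) (by simp)
    · rw [hsl]
      obtain ⟨hpend, hvar⟩ := active_eq_some_iff.1 ha
      refine Finset.mem_filter.2 ⟨hx, fun p hp => ?_, ?_⟩
      -- The bounds coincide at the spilled variables, so lying in the box forces equality with the
      -- start tuple.
      · obtain ⟨h₁, h₂⟩ := h.spilled_prefix j k' hpend p hp
        have := hbox p (by omega)
        rw [hhigh _ h₁, h₂] at this
        exact le_antisymm (by exact_mod_cast this.2) this.1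
      · have := hbox k' (by rw [hvar]; omega)
        rw [hvar, hhigh'] at this
        rw [startTuple_of_active ha]
        exact this

theorem le_maxValue_of_mem_answers {θ : Fin Q.numVars → ℕ} (h : θ ∈ answers Q D)
    (x : Fin Q.numVars) : θ x ≤ maxValue D := by
  obtain ⟨j, p, rfl⟩ := Q.var_cover x
  have h₁ : θ (Q.var j p) ≤ Finset.univ.sup fun p => θ (Q.var j p) :=
    Finset.le_sup (f := fun p => θ (Q.var j p)) (Finset.mem_univ p)
  have h₂ : (Finset.univ.sup fun p => θ (Q.var j p)) ≤
      (D (Q.rel j)).sup fun x => Finset.univ.sup x :=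
    Finset.le_sup (f := fun x : Fin (Q.arity (Q.rel j)) → ℕ => Finset.univ.sup x) (h j)
  have h₃ : ((D (Q.rel j)).sup fun x => Finset.univ.sup x) ≤ maxValue D :=
    Finset.le_sup (f := fun r => (D r).sup fun x => Finset.univ.sup x) (Finset.mem_univ (Q.rel j))
  exact h₁.trans (h₂.trans h₃)

/-- The words `out` list the elements of `A`, each exactly once. -/
def ListsOnce (A : Set (Fin Q.numVars → ℕ)) (out : List ℕ) : Prop :=
  ∃ L : List (Fin Q.numVars → ℕ), L.Nodup ∧ (∀ θ, θ ∈ L ↔ θ ∈ A) ∧ out = L.flatMap List.ofFn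

theorem ListsOnce.append {A A' : Set (Fin Q.numVars → ℕ)} {l l' : List ℕ} (h : ListsOnce A l)
    (h' : ListsOnce A' l') (hd : Disjoint A A') : ListsOnce (A ∪ A') (l ++ l') := by
  obtain ⟨L, hn, hm, rfl⟩ := h
  obtain ⟨L', hn', hm', rfl⟩ := h'
  refine ⟨L ++ L', List.nodup_append'.2 ⟨hn, hn', fun θ h₁ h₂ => ?_⟩, fun θ => ?_, by simp⟩
  · exact Set.disjoint_left.1 hd ((hm θ).1 h₁) ((hm' θ).1 h₂)
  · rw [List.mem_append, hm, hm', Set.mem_union]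

variable (D) in
/-- The answers that are in the box in the first `d` dimensions. -/
def boxAnswers (d : ℕ) (st : BoxState Q) : Set (Fin Q.numVars → ℕ) :=
  {θ | θ ∈ answers Q D ∧
    ∀ x : Fin Q.numVars, (x : ℕ) < d → st.low x ≤ θ x ∧ (θ x : ℕ∞) ≤ st.high x}

theorem boxAnswers_update_low {d : ℕ} {i : Fin Q.numVars} (hi : (i : ℕ) = d) (st : BoxState Q)
    (v : ℕ) : boxAnswers D d { st with low := Function.update st.low i v } = boxAnswers D d st := by
  ext θ
  refine and_congr_right fun _ => forall_congr' fun x => imp_congr_right fun hx => ?_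
  dsimp only
  rw [Function.update_of_ne fun h => by rw [h] at hx; omega]

theorem mem_boxAnswers_succ {d : ℕ} {i : Fin Q.numVars} (hi : (i : ℕ) = d) {mem : ℕ}
    {st : BoxState Q} {θ : Fin Q.numVars → ℕ} :
    θ ∈ boxAnswers D (d + 1) (advance D B st i mem) ↔
      θ ∈ boxAnswers D d st ∧ st.low i ≤ θ i ∧ (θ i : ℕ∞) ≤ upperBound D B st i mem := by
  have hhigh : ∀ e : Fin Q.numVars, (e : ℕ) < d →
      (BoxedJoin.advance D B st i mem).high e = st.high e :=
    fun e he => Function.update_of_ne (fun h => by rw [h] at he; omega) _ _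
  have hhigh' : (BoxedJoin.advance D B st i mem).high i = upperBound D B st i mem :=
    Function.update_self _ _ _
  constructor
  · rintro ⟨h₁, h₂⟩
    refine ⟨⟨h₁, fun x hx => ?_⟩, hhigh' ▸ h₂ i (by omega)⟩
    have := h₂ x (by omega)
    rwa [hhigh x hx] at this
  · rintro ⟨⟨h₁, h₂⟩, h₃⟩
    refine ⟨h₁, fun x hx => ?_⟩
    rcases Nat.lt_succ_iff_lt_or_eq.1 hx with hlt | heq
    · rw [hhigh x hlt]
      exact h₂ x hlt
    · obtain rfl : x = i := Fin.ext (by omega)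
      rw [hhigh']
      exact h₃

/-- The answers up to the upper bound `u` come from this round and those from `u + 1` on from the
later ones, which are disjoint sets. Lower bounds grow by at least one per round, so `fuel` plus the
lower bound never drops below its initial value. -/
theorem listsOnce_repeatRounds {d : ℕ} {i : Fin Q.numVars} (hi : (i : ℕ) = d)
    {body : BoxState Q → List Step × ℕ∞}
    (hlow : ∀ st : BoxState Q, (st.low i : ℕ∞) ≤ (body st).2)
    (h : ∀ st, Invariant D d st → ListsOnce
      {θ | θ ∈ boxAnswers D d st ∧ st.low i ≤ θ i ∧ (θ i : ℕ∞) ≤ (body st).2}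
      (emitted (body st).1)) (fuel : ℕ) {st : BoxState Q} (hst : Invariant D d st)
    (hfuel : maxValue D + 2 ≤ fuel + st.low i) :
    ListsOnce {θ | θ ∈ boxAnswers D d st ∧ st.low i ≤ θ i}
      (emitted (repeatRounds i body fuel st)) := by
  induction fuel generalizing st with
  | zero =>
    -- Without fuel the lower bound exceeds every data value, so no answer is missed.
    refine ⟨[], List.nodup_nil, fun θ => ⟨fun h => absurd h (by simp), fun hθ => ?_⟩, rfl⟩
    have := le_maxValue_of_mem_answers hθ.1.1 i
    have := hθ.2
    omega
  | succ fuel ih =>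
    have hb := h st hst
    have hl := hlow st
    rw [repeatRounds, emitted_append]
    split_ifs with htop
    · simp only [htop, le_top, and_true] at hb
      simpa [emitted] using hb
    · obtain ⟨u, hu⟩ := ENat.ne_top_iff_exists.1 htop
      rw [← hu] at hb hl ⊢
      have hl' : st.low i ≤ u := by exact_mod_cast hl
      have hrest := ih (hst.update_low hi (u + 1)) (by
        simp only [Function.update_self]; omega)
      rw [boxAnswers_update_low hi] at hrest
      simp only [Function.update_self] at hrest
      simp only [ENat.toNat_natCast]
      convert hb.append hrest ?_ using 1
      · ext θ
        simp only [Set.mem_ofPred_eq, Set.mem_union, Nat.cast_le]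
        constructor
        · rintro ⟨h₁, h₂⟩
          rcases Nat.lt_or_ge u (θ i) with h | h
          · exact .inr ⟨h₁, h⟩
          · exact .inl ⟨h₁, h₂, h⟩
        · rintro (⟨h₁, h₂, -⟩ | ⟨h₁, h₂⟩)
          · exact ⟨h₁, h₂⟩
          · exact ⟨h₁, by omega⟩
      · refine Set.disjoint_left.2 fun θ h₁ h₂ => ?_
        have h₃ : θ i ≤ u := by exact_mod_cast h₁.2.2
        have h₄ : u + 1 ≤ θ i := h₂.2
        omega

theorem listsOnce_boxUp (hB : 1 ≤ B) (budget : ℕ) (is : List (Fin Q.numVars)) {d leftover : ℕ}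
    (his : is.map Fin.val = List.range' d is.length) (hd : d + is.length = Q.numVars)
    {st : BoxState Q} (hst : Invariant D d st) :
    ListsOnce (boxAnswers D d st) (emitted (boxUp D B budget is leftover st)) := by
  induction is generalizing d leftover st with
  | nil =>
    obtain rfl : d = Q.numVars := by simpa using hd
    -- A pending atom waits for a variable that is not yet fixed, and none is left.
    have hpend : ∀ j, st.pending j = none := by
      intro j
      cases hp : st.pending j with
      | none => rfl
      | some k => exact absurd (hst.le_var j k hp) (by omega)
    refine ⟨_, nodup_lftj st _ (List.pairwise_lt_finRange _) _, fun θ => ?_, emitted_runLFTJ st⟩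
    rw [mem_lftj_finRange (fun j => hst.subset j (hpend j))
      (fun j x hx hbox => hst.mem_slices j (hpend j) x hx fun p _ => hbox p)]
    exact and_congr_right fun _ => ⟨fun h x _ => h x, fun h x => h x x.2⟩
  | cons i is ih =>
    rw [List.length_cons, List.range'_succ, List.map_cons, List.cons.injEq] at his
    obtain ⟨hi, his⟩ := his
    rw [List.length_cons] at hd
    have hbox : boxAnswers D d st = {θ | θ ∈ boxAnswers D d
        { st with low := Function.update st.low i 0 } ∧ Function.update st.low i 0 i ≤ θ i} := by
      ext θ
      rw [boxAnswers_update_low hi]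
      simp
    rw [boxUp, hbox]
    refine listsOnce_repeatRounds hi (fun st => low_le_upperBound hB) (fun st' hst' => ?_)
      (maxValue D + 2) (hst.update_low hi 0) (by simp)
    rw [emitted_append, emitted_append, emitted_roundSteps, emitted_releaseSteps,
      List.nil_append, List.append_nil]
    convert ih his (by omega) (hst'.advance hB hi) using 1
    ext θ
    exact (mem_boxAnswers_succ hi).symm

end Boxing

/-! ### The reads of the boxing procedure -/

section Cost

variable {Q : JoinQuery} {D : Database Q} {B : ℕ}

variable (D) in
/-- The number of occurrences of values `≥ v` in the columns of the atoms. -/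
def tailCount (v : ℕ) : ℕ :=
  ∑ e : (j : Fin Q.numAtoms) × Fin (Q.arity (Q.rel j)),
    ((D (Q.rel e.1)).filter fun x => v ≤ x e.2).card

theorem tailCount_anti {v w : ℕ} (h : v ≤ w) : tailCount D w ≤ tailCount D v :=
  Finset.sum_le_sum fun _ _ => Finset.card_le_card
    (Finset.monotone_filter_right _ fun _ _ hx => h.trans hx)

/-- In column `k` of atom `j`, the tuples of the slice are counted from `t k` on but no longer from
`h + 1` on; no other column count increases. -/
theorem tailCount_add_card_slice_le {j : Fin Q.numAtoms} {k : Fin (Q.arity (Q.rel j))}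
    {t : Fin (Q.arity (Q.rel j)) → ℕ} {h : ℕ} (hh : t k ≤ h + 1) :
    tailCount D (h + 1) + (slice (D (Q.rel j)) k t h).card ≤ tailCount D (t k) := by
  classical
  have hsum : (slice (D (Q.rel j)) k t h).card =
      ∑ e : (j : Fin Q.numAtoms) × Fin (Q.arity (Q.rel j)),
        if e = ⟨j, k⟩ then (slice (D (Q.rel j)) k t h).card else 0 := by
    rw [Finset.sum_ite_eq' Finset.univ, if_pos (Finset.mem_univ _)]
  rw [hsum, tailCount, tailCount, ← Finset.sum_add_distrib]
  refine Finset.sum_le_sum fun e _ => ?_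
  split_ifs with he
  · subst he
    rw [← Finset.card_union_of_disjoint]
    · refine Finset.card_le_card (Finset.union_subset ?_ ?_)
      · exact Finset.monotone_filter_right _ fun _ _ hx => hh.trans hx
      · exact Finset.monotone_filter_right _ fun _ _ hx => hx.2.1
    · refine Finset.disjoint_left.2 fun x h₁ h₂ => ?_
      have h₃ := (Finset.mem_filter.1 h₁).2
      have h₄ : x k ≤ h := by exact_mod_cast (Finset.mem_filter.1 h₂).2.2.2
      dsimp only at h₃
      omega
  · exact Finset.card_le_card (Finset.monotone_filter_right _ fun _ _ hx => hh.trans hx)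

theorem sum_arity_le (Q : JoinQuery) :
    Fintype.card ((j : Fin Q.numAtoms) × Fin (Q.arity (Q.rel j))) ≤ Q.numAtoms * Q.maxArity := by
  rw [Fintype.card_sigma]
  refine (Finset.sum_le_card_nsmul _ _ Q.maxArity fun j _ => ?_).trans (by simp)
  rw [Fintype.card_fin]
  exact arity_le_maxArity Q _

theorem numVars_le (Q : JoinQuery) : Q.numVars ≤ Q.numAtoms * Q.maxArity := by
  refine le_trans ?_ (sum_arity_le Q)
  have := Fintype.card_le_of_surjective
    (fun e : (j : Fin Q.numAtoms) × Fin (Q.arity (Q.rel j)) => Q.var e.1 e.2) fun x => by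
      obtain ⟨j, p, h⟩ := Q.var_cover x
      exact ⟨⟨j, p⟩, h⟩
  simpa using this

theorem tailCount_le (v : ℕ) : tailCount D v ≤ Q.numAtoms * Q.maxArity * D.size := by
  refine (Finset.sum_le_card_nsmul _ _ D.size fun e _ => ?_).trans ?_
  · refine (Finset.card_filter_le _ _).trans ?_
    exact Finset.single_le_sum (f := fun r => (D r).card) (fun _ _ => Nat.zero_le _)
      (Finset.mem_univ _)
  · rw [smul_eq_mul, Finset.card_univ]
    exact Nat.mul_le_mul_right _ (sum_arity_le Q)

variable (D) in
/-- The potential that decreases by the memory of a dimension in each round but the last. -/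
def potential (v : ℕ) : ℕ :=
  6 * (Q.numAtoms * Q.maxArity) * (tailCount D v + tailCount D (v + 1))

theorem potential_le (v : ℕ) :
    potential D v ≤ 12 * (Q.numAtoms * Q.maxArity) ^ 2 * D.size := by
  have h := Nat.add_le_add (tailCount_le (D := D) v) (tailCount_le (D := D) (v + 1))
  exact (Nat.mul_le_mul_left _ h).trans_eq (by ring)

theorem le_mul_share {st : BoxState Q} {i : Fin Q.numVars} {mem : ℕ} (h : 0 < numActive st i) :
    mem ≤ 2 * Q.numAtoms * share st i mem := by
  have h₁ : mem < (mem / numActive st i + 1) * numActive st i := by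
    have := Nat.lt_div_mul_add (a := mem) h
    rw [Nat.add_mul]; omega
  have h₂ : mem / numActive st i + 1 ≤ 2 * share st i mem := by
    unfold share; omega
  have h₃ := Nat.mul_le_mul h₂ (numActive_le (st := st) (i := i))
  calc mem ≤ 2 * share st i mem * Q.numAtoms := h₁.le.trans h₃
    _ = _ := by ring

theorem numActive_pos {st : BoxState Q} {i : Fin Q.numVars} {j : Fin Q.numAtoms}
    {k : Fin (Q.arity (Q.rel j))} (h : active st i j = some k) : 0 < numActive st i :=
  List.countP_pos_iff.2 ⟨j, List.mem_finRange j, by rw [h]; rfl⟩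

/-- The exceeding slice reaches to `h + 1`, one value into the next round, so its tuples are only
known to be gone from `tailCount` at `h + 2`. Adding the counts at `v` and `v + 1` in the potential
compensates for this overlap. The factor `6` is `2` for rounding the share times `3` from
`words_le_card`. -/
theorem mul_add_potential_le (hB : 1 ≤ B) {st : BoxState Q} {i : Fin Q.numVars} {mem h : ℕ}
    (hu : upperBound D B st i mem = h) :
    mem * B + potential D (h + 1) ≤ potential D (st.low i) := by
  obtain ⟨j, k, ha, hlt⟩ := exists_exceeding_of_upperBound hB hu
  have hlow : st.low i ≤ h := by
    have := low_le_upperBound (D := D) (st := st) (i := i) (mem := mem) hB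
    rw [hu] at this
    exact_mod_cast this
  have htk := startTuple_of_active ha
  have h₁ := tailCount_add_card_slice_le (D := D) (j := j) (k := k) (t := startTuple st j)
    (h := h + 1) (by omega)
  rw [htk] at h₁
  have h₂ := tailCount_anti (D := D) (show st.low i + 1 ≤ h + 1 by omega)
  have h₃ := words_le_card k (slice (D (Q.rel j)) k (startTuple st j) ((h + 1 : ℕ) : ℕ∞))
  set s := (slice (D (Q.rel j)) k (startTuple st j) ((h + 1 : ℕ) : ℕ∞)).card
  have h₄ : mem * B ≤ 6 * (Q.numAtoms * Q.maxArity) * s := by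
    calc mem * B ≤ 2 * Q.numAtoms * share st i mem * B :=
          Nat.mul_le_mul_right _ (le_mul_share (numActive_pos ha))
      _ = 2 * Q.numAtoms * (share st i mem * B) := by ring
      _ ≤ 2 * Q.numAtoms * (3 * Q.maxArity * s) := by
          refine Nat.mul_le_mul_left _ (hlt.le.trans (h₃.trans ?_))
          exact Nat.mul_le_mul_right _ (Nat.mul_le_mul_left _ (arity_le_maxArity Q _))
      _ = _ := by ring
  have h₅ := Nat.mul_le_mul_left (6 * (Q.numAtoms * Q.maxArity))
    (show s + (tailCount D (h + 1) + tailCount D (h + 1 + 1)) ≤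
      tailCount D (st.low i) + tailCount D (st.low i + 1) by omega)
  rw [Nat.mul_add] at h₅
  unfold potential
  omega

/-- Each round but the last lowers the potential by `T`; the summand `T` on the right pays for the
last one. -/
theorem readCount_repeatRounds_le {i : Fin Q.numVars} {body : BoxState Q → List Step × ℕ∞}
    {T : ℕ} {c : ℝ} (hc : 0 ≤ c) (hread : ∀ st, (readCount (body st).1 : ℝ) ≤ c)
    (hprog : ∀ st h, (body st).2 = (h : ℕ) → T + potential D (h + 1) ≤ potential D (st.low i))
    (fuel : ℕ) (st : BoxState Q) :
    (T : ℝ) * readCount (repeatRounds i body fuel st) ≤ c * (T + potential D (st.low i)) := by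
  induction fuel generalizing st with
  | zero =>
    simp only [repeatRounds, readCount, Nat.cast_zero, mul_zero]
    positivity
  | succ fuel ih =>
    rw [repeatRounds, readCount_append, Nat.cast_add, mul_add]
    have h₁ : (T : ℝ) * readCount (body st).1 ≤ c * T := by
      rw [mul_comm c]
      exact mul_le_mul_of_nonneg_left (hread st) (Nat.cast_nonneg T)
    split_ifs with htop
    · have : 0 ≤ c * (potential D (st.low i) : ℝ) := by positivity
      simp only [readCount, Nat.cast_zero, mul_zero]
      linarith
    · obtain ⟨u, hu⟩ := ENat.ne_top_iff_exists.1 htop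
      have h₂ := ih { st with low := Function.update st.low i ((body st).2.toNat + 1) }
      simp only [Function.update_self] at h₂
      have h₃ := hprog st u hu.symm
      rw [← hu, ENat.toNat_natCast] at h₂ ⊢
      have h₄ : ((T : ℝ) + potential D (u + 1)) ≤ potential D (st.low i) := by exact_mod_cast h₃
      have h₅ := mul_le_mul_of_nonneg_left h₄ hc
      linarith

/-- The base of the power bounds the number of rounds of one loop, uniformly in the state. With `W`
for the reads of one round and `ρ` for this base, the recursion is `ρ * (W + l * W * ρ ^ l) ≤ (l +
1) * W * ρ ^ (l + 1)`. -/
theorem readCount_boxUp_le (hB : 1 ≤ B) {budget S : ℕ} (hbudget : 1 ≤ budget)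
    (is : List (Fin Q.numVars)) {leftover : ℕ} (hS : leftover + budget * is.length ≤ S)
    (st : BoxState Q) :
    (readCount (boxUp D B budget is leftover st) : ℝ) ≤
      is.length * (12 * (Q.numAtoms * Q.maxArity) * S) *
        (1 + 12 * (Q.numAtoms * Q.maxArity) ^ 2 * D.size / (budget * B)) ^ is.length := by
  induction is generalizing leftover st with
  | nil => simp [boxUp, readCount_runLFTJ]
  | cons i is ih =>
    set W : ℝ := 12 * (Q.numAtoms * Q.maxArity) * S with hW
    set ρ : ℝ := 1 + 12 * (Q.numAtoms * Q.maxArity) ^ 2 * D.size / (budget * B) with hρ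
    have hW0 : 0 ≤ W := by positivity
    have hρ1 : 1 ≤ ρ := le_add_of_nonneg_right (by positivity)
    have hT : (0 : ℝ) < budget * B := by
      have : 0 < budget * B := Nat.mul_pos hbudget hB
      exact_mod_cast this
    rw [List.length_cons, Nat.mul_succ] at hS
    have hmem : budget + leftover ≤ S := by omega
    have hround : ∀ st' : BoxState Q,
        (readCount (roundSteps D B st' i (budget + leftover)) : ℝ) ≤ W := by
      intro st'
      have h₁ := readCount_roundSteps_le (D := D) (st := st') (i := i) (mem := budget + leftover) hB
      have h₂ : share st' i (budget + leftover) ≤ S :=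
        max_le (by omega) ((Nat.div_le_self _ _).trans hmem)
      have h₃ := h₁.trans (Nat.mul_le_mul_left _ h₂)
      rw [hW]
      exact_mod_cast h₃
    have hloop := readCount_repeatRounds_le (D := D) (i := i) (T := budget * B)
      (body := fun st => (roundSteps D B st i (budget + leftover) ++
            boxUp D B budget is (budget + leftover - usedMem D B st i (budget + leftover))
              (advance D B st i (budget + leftover)) ++
            releaseSteps D B st i (budget + leftover),
          upperBound D B st i (budget + leftover)))
      (c := W + is.length * W * ρ ^ is.length) (by positivity)
      (fun st' => by
        dsimp only
        rw [readCount_append, readCount_append, readCount_releaseSteps, Nat.add_zero, Nat.cast_add]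
        exact add_le_add (hround st') (ih (by omega) _))
      (fun st' h hh => by
        refine le_trans (Nat.add_le_add_right (Nat.mul_le_mul_right B ?_) _)
          (mul_add_potential_le hB hh)
        exact Nat.le_add_right _ _)
      (maxValue D + 2) { st with low := Function.update st.low i 0 }
    have hpot : (potential D (Function.update st.low i 0 i) : ℝ) ≤
        12 * (Q.numAtoms * Q.maxArity) ^ 2 * D.size := by
      exact_mod_cast potential_le (D := D) _
    have hTρ : (budget * B : ℝ) * ρ =
        budget * B + 12 * (Q.numAtoms * Q.maxArity) ^ 2 * D.size := by
      rw [hρ]; field_simp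
    rw [boxUp, List.length_cons]
    refine le_of_mul_le_mul_left ?_ hT
    push_cast at hloop
    refine hloop.trans ?_
    have hpow : 1 ≤ ρ ^ is.length := one_le_pow₀ hρ1
    calc (W + is.length * W * ρ ^ is.length) *
          (budget * B + potential D (Function.update st.low i 0 i))
        ≤ (W * ρ ^ is.length + is.length * W * ρ ^ is.length) * (budget * B * ρ) := by
          rw [hTρ]
          gcongr
          exact le_mul_of_one_le_right hW0 hpow
      _ = _ := by push_cast; ring

end Cost

/-! ### The upper bound -/

theorem ListsAnswersOnce.length_eq {Q : JoinQuery} {D : Database Q} {out : List ℕ}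
    (h : ListsAnswersOnce Q D out) : out.length = (answers Q D).ncard * Q.numVars := by
  classical
  obtain ⟨L, hn, hm, rfl⟩ := h
  have : answers Q D = (L.toFinset : Set _) := by
    ext θ
    simp [hm]
  rw [this, Set.ncard_coe_finset, List.toFinset_card_of_nodup hn, List.length_flatMap]
  simp

/-- Bounds on the memory that is divided among the dimensions. -/
theorem slicesMem_bounds {Q : JoinQuery} {M B : ℕ} (hB : 1 ≤ B)
    (hM : 10 * (Q.numAtoms * Q.maxArity) * B ≤ M) :
    1 ≤ slicesMem Q M B / Q.numVars ∧ M ≤ 8 * Q.numVars * (slicesMem Q M B / Q.numVars * B) ∧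
      (slicesMem Q M B + Q.numAtoms + 2 * Q.maxArity + 1) * B ≤ M := by
  have hn := Q.numVars_pos
  have hnle := numVars_le Q
  obtain ⟨j, -, -⟩ := Q.var_cover ⟨0, hn⟩
  have hm : 1 ≤ Q.numAtoms := by have := j.2; omega
  have ha : 1 ≤ Q.maxArity := (Q.arity_pos _).trans_le (arity_le_maxArity Q (Q.rel j))
  have hma₁ : Q.numAtoms ≤ Q.numAtoms * Q.maxArity := Nat.le_mul_of_pos_right _ ha
  have hma₂ : Q.maxArity ≤ Q.numAtoms * Q.maxArity := Nat.le_mul_of_pos_left _ hm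
  have hq : 10 * (Q.numAtoms * Q.maxArity) ≤ M / B := (Nat.le_div_iff_mul_le hB).2 hM
  have hqB : M / B * B ≤ M := Nat.div_mul_le_self M B
  have hqB' := Nat.lt_div_mul_add (a := M) hB
  have hS : slicesMem Q M B + (Q.numAtoms + 2 * Q.maxArity + 1) = M / B := by
    unfold slicesMem; omega
  generalize slicesMem Q M B = S at hS ⊢
  -- At most `4ma` of the at least `10ma` blocks are set aside, where `m` is the number of atoms and
  -- `a` the maximal arity; the remaining `6ma` exceed `n ≤ ma`.
  have hSn : Q.numVars ≤ S := by omega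
  have hdiv : 1 ≤ S / Q.numVars := (Nat.one_le_div_iff hn).2 hSn
  have hb := Nat.lt_div_mul_add (a := S) hn
  refine ⟨hdiv, ?_, ?_⟩
  · have h₁ : S ≤ 2 * Q.numVars * (S / Q.numVars) := by
      have h := Nat.mul_le_mul_left Q.numVars hdiv
      have h' : S / Q.numVars * Q.numVars = Q.numVars * (S / Q.numVars) := Nat.mul_comm _ _
      rw [Nat.mul_assoc]
      omega
    have h₂ : M ≤ 4 * S * B := by
      have h := Nat.mul_le_mul_right B (show M / B + 1 ≤ 4 * S by omega)
      rw [Nat.add_mul] at h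
      omega
    calc M ≤ 4 * S * B := h₂
      _ ≤ 4 * (2 * Q.numVars * (S / Q.numVars)) * B := by gcongr
      _ = _ := by ring
  · rw [show S + Q.numAtoms + 2 * Q.maxArity + 1 = M / B by omega]
    exact hqB

/-- One block is kept for the output buffer, whence the capacity `M - B`. Initially all atoms are
pending, which uses exactly the reserve of one block per atom. -/
theorem boxedLFTJ_runs {Q : JoinQuery} (D : Database Q) {M B : ℕ} (hB : 1 ≤ B)
    (hM : 10 * (Q.numAtoms * Q.maxArity) * B ≤ M) :
    Runs B (M - B) 0 (boxUp D B (slicesMem Q M B / Q.numVars) (List.finRange Q.numVars) 0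
      (initialState Q)) 0 := by
  obtain ⟨-, -, h⟩ := slicesMem_bounds hB hM
  refine runs_boxUp hB _ _ ?_
  have h₁ : numPending (initialState Q) = Q.numAtoms := by simp [numPending, initialState]
  have h₂ : slicesMem Q M B / Q.numVars * Q.numVars ≤ slicesMem Q M B := Nat.div_mul_le_self _ _
  have h₃ : (slicesMem Q M B / Q.numVars * Q.numVars + Q.numAtoms) * B ≤
      (slicesMem Q M B + Q.numAtoms) * B := Nat.mul_le_mul_right _ (by omega)
  rw [h₁, List.length_finRange]
  simp only [Nat.add_mul, Nat.zero_mul, Nat.one_mul] at h h₃ ⊢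
  omega

theorem boxedLFTJ_listsAnswersOnce {Q : JoinQuery} (D : Database Q) {M B : ℕ} (hB : 1 ≤ B) :
    ListsAnswersOnce Q D (emitted (boxUp D B (slicesMem Q M B / Q.numVars)
      (List.finRange Q.numVars) 0 (initialState Q))) := by
  obtain ⟨L, hn, hm, he⟩ := listsOnce_boxUp (leftover := 0) hB (slicesMem Q M B / Q.numVars)
    (List.finRange Q.numVars) (d := 0)
    (by rw [List.length_finRange, ← List.range_eq_range', List.map_coe_finRange_eq_range])
    (by simp) (invariant_initialState D)
  exact ⟨L, hn, fun θ => (hm θ).trans ⟨fun h => h.1, fun h => ⟨h, fun x hx => absurd hx (by omega)⟩⟩,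
    he⟩

theorem boxedLFTJ_ioCost_le {Q : JoinQuery} (D : Database Q) {M B : ℕ} {lam : ℝ} (hB : 1 ≤ B)
    (hM : 10 * (Q.numAtoms * Q.maxArity) * B ≤ M) (hlam : (M : ℝ) ≤ lam * D.size) :
    (ioCost (boxedLFTJ D B M) : ℝ) ≤
      (Q.numVars * (12 * (Q.numAtoms * Q.maxArity)) + 1) *
          (lam + 96 * Q.numVars * (Q.numAtoms * Q.maxArity) ^ 2) ^ Q.numVars *
          ((D.size : ℝ) ^ Q.numVars / ((M : ℝ) ^ (Q.numVars - 1) * B)) +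
        Q.numVars * ((answers Q D).ncard / B) := by
  obtain ⟨hb, hT, hS⟩ := slicesMem_bounds hB hM
  have hn := Q.numVars_pos
  have hruns := boxedLFTJ_runs D hB hM
  have hio := hruns.ioCost_bufferOutput_le []
  have hlen := (boxedLFTJ_listsAnswersOnce (M := M) D hB).length_eq
  have hread := readCount_boxUp_le (D := D) (S := slicesMem Q M B) hB hb (List.finRange Q.numVars)
    (leftover := 0) (by simpa using Nat.div_mul_le_self _ _) (initialState Q)
  rw [hlen, List.length_nil, Nat.zero_add] at hio
  rw [List.length_finRange] at hread
  change B * ioCost (boxedLFTJ D B M) ≤ _ at hio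
  set reads := readCount (boxUp D B (slicesMem Q M B / Q.numVars) (List.finRange Q.numVars) 0
    (initialState Q))
  set budget := slicesMem Q M B / Q.numVars
  set S := slicesMem Q M B
  set K := (answers Q D).ncard
  set n := Q.numVars
  have hBr : (1 : ℝ) ≤ B := by exact_mod_cast hB
  have hSBn : S * B ≤ M := le_trans (Nat.mul_le_mul_right B (by omega)) hS
  have hBM : B ≤ M := le_trans (Nat.le_mul_of_pos_left B (by omega)) hS
  have hMpos : (0 : ℝ) < M := lt_of_lt_of_le (by linarith) (show (B : ℝ) ≤ M by exact_mod_cast hBM)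
  have hSB : (S : ℝ) ≤ M / B := by
    rw [le_div_iff₀ (by linarith)]; exact_mod_cast hSBn
  have hTr : (M : ℝ) / (8 * n) ≤ budget * B := by
    rw [div_le_iff₀ (by positivity), mul_comm]; exact_mod_cast hT
  have hT0 : (0 : ℝ) < M / (8 * n) := by positivity
  set A : ℝ := (Q.numAtoms * Q.maxArity : ℝ)
  set κ : ℝ := lam + 96 * n * A ^ 2
  -- The `1` for the last round of a loop is absorbed by `M ≤ lam * |I|`; the factor `96 * n` is
  -- `12` times the loss `8 * n` from splitting the memory.
  have hρ : 1 + 12 * A ^ 2 * D.size / (budget * B) ≤ κ * (D.size / M) := by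
    have h₁ : 1 ≤ lam * (D.size / M) := by
      rw [← mul_div_assoc, le_div_iff₀ hMpos]; linarith
    have h₂ : 12 * A ^ 2 * D.size / (budget * B) ≤ 12 * A ^ 2 * D.size / (M / (8 * n)) := by
      gcongr
    have h₃ : 12 * A ^ 2 * D.size / (M / (8 * n)) = 96 * n * A ^ 2 * (D.size / M) := by
      field_simp; ring
    rw [add_mul]
    linarith
  have hρ1 : 1 ≤ 1 + 12 * A ^ 2 * D.size / (budget * B) := le_add_of_nonneg_right (by positivity)
  have hpow : (1 + 12 * A ^ 2 * D.size / (budget * B)) ^ n ≤ (κ * (D.size / M)) ^ n := by gcongr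
  have hpow1 : 1 ≤ (κ * (D.size / M)) ^ n := one_le_pow₀ (hρ1.trans hρ)
  have hMn : (M : ℝ) ^ n = M ^ (n - 1) * M := by rw [← pow_succ, Nat.sub_add_cancel hn]
  have hmain : (κ * (D.size / M)) ^ n * (M / B) =
      κ ^ n * ((D.size : ℝ) ^ n / ((M : ℝ) ^ (n - 1) * B)) := by
    rw [mul_pow, div_pow, hMn]; field_simp
  have hreads : (reads : ℝ) ≤ n * (12 * A) * ((κ * (D.size / M)) ^ n * (M / B)) := by
    calc (reads : ℝ) ≤ n * (12 * A * S) * (1 + 12 * A ^ 2 * D.size / (budget * B)) ^ n := hread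
      _ ≤ n * (12 * A * (M / B)) * (κ * (D.size / M)) ^ n := by gcongr
      _ = _ := by ring
  -- Absorbs the write of the last partial block into the main term.
  have hone : 1 ≤ (κ * (D.size / M)) ^ n * (M / B) := by
    refine one_le_mul_of_one_le_of_one_le hpow1 ?_
    rw [le_div_iff₀ (by linarith), one_mul]
    exact_mod_cast hBM
  have hio' : (ioCost (boxedLFTJ D B M) : ℝ) ≤ reads + n * (K / B) + 1 := by
    refine le_of_mul_le_mul_left ?_ (show (0 : ℝ) < B by linarith)
    have : (B : ℝ) * ioCost (boxedLFTJ D B M) ≤ B * reads + K * n + B := by exact_mod_cast hio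
    refine this.trans_eq ?_
    field_simp
  calc (ioCost (boxedLFTJ D B M) : ℝ) ≤ reads + n * (K / B) + 1 := hio'
    _ ≤ (n * (12 * A) + 1) * ((κ * (D.size / M)) ^ n * (M / B)) + n * (K / B) := by linarith
    _ = _ := by rw [hmain]; ring

/-! ### The lower bound -/

theorem Admissible.length_written_le {M B c : ℕ} {tr : List Op} (h : Admissible M B c tr) :
    (written tr).length ≤ B * writeCost tr := by
  induction tr generalizing c with
  | nil => exact Nat.zero_le _
  | cons op tr ih =>
    cases op with
    | write data =>
      obtain ⟨h₁, -, h₂⟩ := h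
      have := ih h₂
      simp only [written, writeCost, List.length_append, Nat.mul_add]
      omega
    | read _ => exact ih h.2
    | compute _ => exact ih h.2
    | discard _ => exact ih h.2

theorem writeCost_le_ioCost (tr : List Op) : writeCost tr ≤ ioCost tr := by
  induction tr with
  | nil => exact le_rfl
  | cons op tr ih => cases op <;> simp only [writeCost, ioCost] <;> omega

theorem ListsAnswers.ncard_le_length {Q : JoinQuery} {D : Database Q} {out : List ℕ}
    (h : ListsAnswers Q D out) : (answers Q D).ncard ≤ out.length := by
  classical
  obtain ⟨L, hm, rfl⟩ := h
  have : answers Q D = (L.toFinset : Set _) := by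
    ext θ
    simp [hm]
  rw [this, Set.ncard_coe_finset, List.length_flatMap]
  simp only [List.length_ofFn, List.map_const', List.sum_replicate, smul_eq_mul]
  exact (List.toFinset_card_le L).trans (Nat.le_mul_of_pos_right _ Q.numVars_pos)

/-- The number of values of the relation `i` if `N` values are distributed to `n` relations. -/
def evenShare (n N : ℕ) (i : Fin n) : ℕ := N / n + if (i : ℕ) = 0 then N % n else 0

/-- An input of size `N` for the Cartesian product. -/
def evenDatabase (n : ℕ) (hn : 0 < n) (N : ℕ) : Database (cartesian n hn) :=
  fun i => (Finset.range (evenShare n N i)).image fun v _ => v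

theorem sum_evenShare {n : ℕ} (hn : 0 < n) (N : ℕ) : ∑ i, evenShare n N i = N := by
  have h : ∑ i : Fin n, (if (i : ℕ) = 0 then N % n else 0) = N % n := by
    rw [Finset.sum_eq_single (⟨0, hn⟩ : Fin n)]
    · simp
    · intro i _ hi
      rw [if_neg fun h => hi (Fin.ext h)]
    · simp
  simp only [evenShare, Finset.sum_add_distrib, h, Finset.sum_const, Finset.card_univ,
    Fintype.card_fin, smul_eq_mul]
  exact Nat.div_add_mod N n

theorem size_evenDatabase {n : ℕ} (hn : 0 < n) (N : ℕ) : (evenDatabase n hn N).size = N := by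
  refine Eq.trans (Finset.sum_congr rfl fun i _ => ?_) (sum_evenShare hn N)
  refine (Finset.card_image_of_injective _ fun v w h => congrFun h (0 : Fin 1)).trans ?_
  exact Finset.card_range _

theorem ncard_answers_evenDatabase {n : ℕ} (hn : 0 < n) (N : ℕ) :
    (answers _ (evenDatabase n hn N)).ncard = ∏ i, evenShare n N i := by
  have : answers _ (evenDatabase n hn N) =
      (Fintype.piFinset fun i => Finset.range (evenShare n N i) : Set (Fin n → ℕ)) := by
    refine Set.ext fun θ =>
      Iff.trans (forall_congr' fun i => ?_) (Finset.mem_coe.trans Fintype.mem_piFinset).symm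
    refine Finset.mem_image.trans ⟨?_, fun h => ⟨_, h, rfl⟩⟩
    rintro ⟨v, hv, h⟩
    have hv' : v = θ i := congrFun h (0 : Fin 1)
    rwa [hv'] at hv
  refine (congrArg Set.ncard this).trans ((Set.ncard_coe_finset _).trans ?_)
  refine (Fintype.card_piFinset fun i => Finset.range (evenShare n N i)).trans ?_
  simp only [Finset.card_range]

theorem pow_le_ncard_answers {n N : ℕ} (hn : 0 < n) (hN : n ≤ N) :
    (1 / (2 * n : ℝ)) ^ n * (N : ℝ) ^ n ≤ (answers _ (evenDatabase n hn N)).ncard := by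
  rw [ncard_answers_evenDatabase, Nat.cast_prod, ← mul_pow]
  refine le_of_eq_of_le (b := ∏ _i : Fin n, (1 / (2 * n : ℝ) * N)) (by simp) ?_
  refine Finset.prod_le_prod (fun _ _ => by positivity) fun i _ => ?_
  -- Since `N ≥ n`, rounding `N / n` down loses at most a factor of two.
  have h₁ : N ≤ 2 * n * evenShare n N i := by
    have h₂ : 1 ≤ N / n := (Nat.one_le_div_iff hn).2 hN
    have h₃ := Nat.lt_div_mul_add (a := N) hn
    have h₄ := Nat.mul_le_mul_right n h₂
    calc N ≤ 2 * (N / n * n) := by omega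
      _ = 2 * n * (N / n) := by ring
      _ ≤ _ := Nat.mul_le_mul_left _ (Nat.le_add_right _ _)
  have h₅ : (N : ℝ) ≤ 2 * n * evenShare n N i := by exact_mod_cast h₁
  rw [one_div_mul_eq_div, div_le_iff₀ (by positivity)]
  linarith

theorem ncard_answers_le_pow {n : ℕ} (hn : 0 < n) (N : ℕ) :
    (answers _ (evenDatabase n hn N)).ncard ≤ N ^ n := by
  rw [ncard_answers_evenDatabase]
  refine (Finset.prod_le_prod' fun i _ => (?_ : _ ≤ N)).trans_eq (by simp)
  exact (Finset.single_le_sum (f := evenShare n N) (fun _ _ => Nat.zero_le _)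
    (Finset.mem_univ i)).trans_eq (sum_evenShare hn N)

end BoxedJoin

/-! ### Assembly of the upper and the lower bound -/

theorem mainTheorem3 :
    (∀ (Q : BoxedJoin.JoinQuery) (lam : ℝ), ∃ C : ℝ, 0 < C ∧
      ∀ (M B : ℕ) (D : BoxedJoin.Database Q),
        1 ≤ B → 10 * (Q.numAtoms * Q.maxArity) * B ≤ M → (M : ℝ) ≤ lam * (D.size : ℝ) →
        BoxedJoin.Admissible M B 0 (BoxedJoin.boxedLFTJ D B M) ∧
        BoxedJoin.ListsAnswersOnce Q D (BoxedJoin.written (BoxedJoin.boxedLFTJ D B M)) ∧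
        (BoxedJoin.ioCost (BoxedJoin.boxedLFTJ D B M) : ℝ) ≤
          C * ((D.size : ℝ) ^ Q.numVars / ((M : ℝ) ^ (Q.numVars - 1) * (B : ℝ)) +
            ((BoxedJoin.answers Q D).ncard : ℝ) / (B : ℝ))) ∧
    (∀ (n : ℕ) (hn : 0 < n), ∃ c : ℝ, 0 < c ∧
      ∀ N : ℕ, n ≤ N → ∃ D : BoxedJoin.Database (BoxedJoin.cartesian n hn),
        D.size = N ∧
        c * (N : ℝ) ^ n ≤ ((BoxedJoin.answers _ D).ncard : ℝ) ∧
        ((BoxedJoin.answers _ D).ncard : ℝ) ≤ (N : ℝ) ^ n ∧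
        ∀ (M B : ℕ) (tr : List BoxedJoin.Op), 1 ≤ B →
          BoxedJoin.Admissible M B 0 tr →
          BoxedJoin.ListsAnswers _ D (BoxedJoin.written tr) →
          c * ((N : ℝ) ^ n / (B : ℝ)) ≤ (BoxedJoin.writeCost tr : ℝ) ∧
          c * ((N : ℝ) ^ n / ((M : ℝ) ^ (n - 1) * (B : ℝ)) +
            ((BoxedJoin.answers _ D).ncard : ℝ) / (B : ℝ)) ≤ (BoxedJoin.ioCost tr : ℝ)) := by
  constructor
  · intro Q lam
    set A : ℝ := (Q.numVars * (12 * (Q.numAtoms * Q.maxArity)) + 1) *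
      (lam + 96 * Q.numVars * (Q.numAtoms * Q.maxArity) ^ 2) ^ Q.numVars with hA
    refine ⟨max A Q.numVars, lt_max_of_lt_right (by exact_mod_cast Q.numVars_pos), ?_⟩
    intro M B D hB hM hlam
    have hruns := BoxedJoin.boxedLFTJ_runs D hB hM
    have hBM : B ≤ M := by
      obtain ⟨-, -, h⟩ := BoxedJoin.slicesMem_bounds hB hM
      exact le_trans (Nat.le_mul_of_pos_left B (by omega)) h
    refine ⟨hruns.admissible_bufferOutput hB (by omega) (Nat.zero_le _) [] hB, ?_, ?_⟩
    · rw [BoxedJoin.boxedLFTJ, hruns.written_bufferOutput, List.nil_append]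
      exact BoxedJoin.boxedLFTJ_listsAnswersOnce D hB
    · refine (BoxedJoin.boxedLFTJ_ioCost_le D hB hM hlam).trans ?_
      rw [mul_add]
      gcongr
      · exact le_max_left _ _
      · exact le_max_right _ _
  · intro n hn
    have hn1 : (1 : ℝ) ≤ n := by exact_mod_cast hn
    have hc0 : 0 < (1 / (2 * n : ℝ)) ^ n := by positivity
    have hc1 : (1 / (2 * n : ℝ)) ^ n ≤ 1 :=
      pow_le_one₀ (by positivity) ((div_le_one (by positivity)).2 (by linarith))
    -- The half splits the write bound `K / B` between the two summands of the I/O bound.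
    refine ⟨(1 / (2 * n : ℝ)) ^ n / 2, by positivity, fun N hN => ?_⟩
    have hlow := BoxedJoin.pow_le_ncard_answers hn hN
    refine ⟨BoxedJoin.evenDatabase n hn N, BoxedJoin.size_evenDatabase hn N, ?_,
      by exact_mod_cast BoxedJoin.ncard_answers_le_pow hn N, ?_⟩
    · have : (0 : ℝ) ≤ (1 / (2 * n : ℝ)) ^ n * (N : ℝ) ^ n := by positivity
      linarith
    intro M B tr hB hadm hlist
    set K := (BoxedJoin.answers _ (BoxedJoin.evenDatabase n hn N)).ncard
    set c : ℝ := (1 / (2 * n : ℝ)) ^ n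
    have hBr : (0 : ℝ) < B := by exact_mod_cast hB
    have hKw : (K : ℝ) / B ≤ BoxedJoin.writeCost tr := by
      rw [div_le_iff₀' hBr]
      exact_mod_cast hlist.ncard_le_length.trans hadm.length_written_le
    have hwio : (BoxedJoin.writeCost tr : ℝ) ≤ BoxedJoin.ioCost tr := by
      exact_mod_cast BoxedJoin.writeCost_le_ioCost tr
    have hcN : c * ((N : ℝ) ^ n / B) ≤ K / B := by
      rw [← mul_div_assoc]
      gcongr
    have hN0 : (0 : ℝ) ≤ (N : ℝ) ^ n / B := by positivity
    have hK0 : (0 : ℝ) ≤ (K : ℝ) / B := by positivity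
    have hdrop : (N : ℝ) ^ n / ((M : ℝ) ^ (n - 1) * B) ≤ (N : ℝ) ^ n / B := by
      -- For `M = 0` and `n > 1` the quotient is `0` by the convention for division by zero.
      rcases Nat.eq_zero_or_pos (M ^ (n - 1)) with h | h
      · have hM0 : (M : ℝ) ^ (n - 1) = 0 := by exact_mod_cast h
        rw [hM0, zero_mul, div_zero]
        exact hN0
      · have hM1 : (1 : ℝ) ≤ (M : ℝ) ^ (n - 1) := by exact_mod_cast h
        exact div_le_div_of_nonneg_left (by positivity) hBr (le_mul_of_one_le_left hBr.le hM1)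
    refine ⟨by nlinarith, ?_⟩
    have h₁ := mul_le_mul_of_nonneg_left hdrop hc0.le
    have h₂ := mul_le_mul_of_nonneg_right hc1 hK0
    linarith
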